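/- A water trading instance consists of a finite set $S$ of sellers, a finite set $B$ of buyers, a bipartite compatibility graph $G(S,B,E)$, for every agent $a\in S\cup B$ an ordered list $\Gamma_a=(w^a_1,\dots,w^a_{\gamma_a})$ of water units with a value function $f_a:\Gamma_a\to\mathbb{R}_{\ge 0}$, and for every buyer $b$ an integer lower bound $r(\{b\})\ge 0$ (the value $0$ meaning that no bound is imposed on $b$). A *trading assignment* $\mathcal T$ is a set of pairs $(w^s_i,w^b_j)$ of a seller's unit and a buyer's unit with $\{s,b\}\in E$, in which every unit occurs in at most one pair. It is *valid* if (i) $f_b(w^b_j)\ge f_s(w^s_i)$ for every pair $(w^s_i,w^b_j)\in\mathcal T$, and (ii) for every agent $a$ and every $i>1$, the unit $w^a_i$ is matched only if $w^a_{i-1}$ is matched. Its welfare is $\sum_{(w^s_i,w^b_j)\in\mathcal T}\bigl[f_b(w^b_j)-f_s(w^s_i)\bigr]$. Let $\mathcal M$ be the set of all valid trading assignments in which every buyer $b$ is assigned at least $r(\{b\})$ units. **Corollary.** There is a deterministic algorithm with the following property. On every instance in which $f_s$ is non-decreasing ($f_s(w^s_i)\ge f_s(w^s_{i-1})$ for $i>1$)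 for every seller $s$, $f_b$ is non-increasing ($f_b(w^b_j)\le f_b(w^b_{j-1})$ for $j>1$) for every buyer $b$, and $\mathcal M\neq\emptyset$, it finds, in time polynomial in the total number of agents and water units, a valid trading assignment $\mathcal T$ such that 1. every buyer $b\in B$ is assigned at least $r(\{b\})$ units in $\mathcal T$, and 2. the welfare of $\mathcal T$ is at least the maximum welfare among all assignments in $\mathcal M$. Here time is the number of steps of a random access machine, with one fixed program for all instances, that in one step performs a memory access (indices are computed natural numbers), or an addition, a subtraction or a comparison of two natural numbers or of two real numbers. -/

import Mathlib

open scoped NNReal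

namespace WaterTrading

noncomputable section

/-! ### Instances and trading assignments -/

/-- An instance of the water trading problem with lower bounds for individual buyers.
Sellers are `Fin nS`, buyers are `Fin nB`; agent `a` has `γ_a` water units, listed in the order
in which they have to be sold or bought (positions are counted from `0`). -/
structure Instance where
  /-- number of sellers -/
  nS : ℕ
  /-- number of buyers -/
  nB : ℕ
  /-- number of water units of each seller (her capacity) -/
  γS : Fin nS → ℕ
  /-- number of water units of each buyer (her requirement) -/
  γB : Fin nB → ℕ
  /-- the seller--buyer compatibility graph -/
  compat : Fin nS → Fin nB → Prop
  /-- value functions of the sellers -/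
  fS : (s : Fin nS) → Fin (γS s) → ℝ≥0
  /-- value functions of the buyers -/
  fB : (b : Fin nB) → Fin (γB b) → ℝ≥0
  /-- lower bound on the number of units assigned to each buyer (`0` means no constraint) -/
  r : Fin nB → ℕ

namespace Instance

variable (I : Instance)

/-- The water units of all sellers: `⟨s, i⟩` is unit number `i` of seller `s`. -/
abbrev SUnit : Type := Σ s : Fin I.nS, Fin (I.γS s)

/-- The water units of all buyers: `⟨b, j⟩` is unit number `j` of buyer `b`. -/
abbrev BUnit : Type := Σ b : Fin I.nB, Fin (I.γB b)

/-- Sellers' value functions are non-decreasing and buyers' value functions non-increasing. -/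
def MonotoneValues : Prop :=
  (∀ s, Monotone (I.fS s)) ∧ (∀ b, Antitone (I.fB b))

/-- The total number of agents and water units. (If every agent has at least one unit, this is
at most twice the number of water units.) -/
def size : ℕ := I.nS + I.nB + ∑ s, I.γS s + ∑ b, I.γB b

variable {I}

/-- A trading assignment is a matching between sellers' units and buyers' units in which only
units of compatible agents are matched. -/
def IsAssignment (T : Finset (I.SUnit × I.BUnit)) : Prop :=
  (∀ p ∈ T, I.compat p.1.1 p.2.1) ∧
  (∀ p ∈ T, ∀ q ∈ T, p.1 = q.1 → p = q) ∧
  (∀ p ∈ T, ∀ q ∈ T, p.2 = q.2 → p = q)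

/-- The seller's unit `u` is matched in `T`. -/
def SMatched (T : Finset (I.SUnit × I.BUnit)) (u : I.SUnit) : Prop := ∃ v, (u, v) ∈ T

/-- The buyer's unit `v` is matched in `T`. -/
def BMatched (T : Finset (I.SUnit × I.BUnit)) (v : I.BUnit) : Prop := ∃ u, (u, v) ∈ T

/-- A valid trading assignment: in every matched pair the buyer values the unit at least as much
as the seller, and a unit of an agent other than the first is matched only if the preceding unit
of the same agent is matched. -/
def IsValid (T : Finset (I.SUnit × I.BUnit)) : Prop :=
  IsAssignment T ∧
  (∀ p ∈ T, I.fS p.1.1 p.1.2 ≤ I.fB p.2.1 p.2.2) ∧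
  (∀ (s : Fin I.nS) (i i' : Fin (I.γS s)), (i' : ℕ) + 1 = i →
    SMatched T ⟨s, i⟩ → SMatched T ⟨s, i'⟩) ∧
  (∀ (b : Fin I.nB) (j j' : Fin (I.γB b)), (j' : ℕ) + 1 = j →
    BMatched T ⟨b, j⟩ → BMatched T ⟨b, j'⟩)

/-- The number of water units assigned to buyer `b`. -/
def assigned (T : Finset (I.SUnit × I.BUnit)) (b : Fin I.nB) : ℕ :=
  (T.filter fun p => p.2.1 = b).card

/-- A feasible assignment: a valid trading assignment meeting the lower bound of every buyer. -/
def IsFeasible (T : Finset (I.SUnit × I.BUnit)) : Prop :=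
  IsValid T ∧ ∀ b, I.r b ≤ assigned T b

/-- The welfare of a trading assignment. -/
def welfare (T : Finset (I.SUnit × I.BUnit)) : ℝ :=
  ∑ p ∈ T, ((I.fB p.2.1 p.2.2 : ℝ) - (I.fS p.1.1 p.1.2 : ℝ))

end Instance

/-! ### The machine model

A random access machine working with natural numbers and real numbers. The memory consists of
two-dimensional arrays of natural numbers and of real numbers; a program mentions finitely many
of them by name (a number), and indices are computed at run time. A scalar is the entry `(0, 0)`
of an array. Numbers can be added, subtracted and compared only: there is no multiplication, no
rounding, and no conversion between reals and naturals. Every elementary operation takes one time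
unit. -/

/-- The contents of the memory: `nat x i k` is the entry `(i, k)` of the array of natural numbers
named `x`, and `real x i k` the entry `(i, k)` of the array of real numbers named `x`. -/
structure Memory where
  nat : ℕ → ℕ → ℕ → ℕ
  real : ℕ → ℕ → ℕ → ℝ

/-- Overwrite the entry `(i, k)` of the array `x`. -/
def update {α : Type} (m : ℕ → ℕ → ℕ → α) (x i k : ℕ) (a : α) : ℕ → ℕ → ℕ → α :=
  fun x' i' k' => if x' = x ∧ i' = i ∧ k' = k then a else m x' i' k'

/-- Expressions for natural numbers. -/
inductive NExp : Type
  | const (c : ℕ)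
  | read (x : ℕ) (i k : NExp)
  | add (a b : NExp)
  | sub (a b : NExp)

/-- Value of an expression; subtraction is truncated at `0`. -/
def NExp.eval (m : Memory) : NExp → ℕ
  | .const c => c
  | .read x i k => m.nat x (i.eval m) (k.eval m)
  | .add a b => a.eval m + b.eval m
  | .sub a b => a.eval m - b.eval m

/-- Number of operations in the evaluation of an expression. -/
def NExp.cost : NExp → ℕ
  | .const _ => 1
  | .read _ i k => i.cost + k.cost + 1
  | .add a b => a.cost + b.cost + 1
  | .sub a b => a.cost + b.cost + 1

/-- Expressions for real numbers. -/
inductive RExp : Type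
  | zero
  | one
  | read (x : ℕ) (i k : NExp)
  | add (a b : RExp)
  | sub (a b : RExp)

/-- Value of an expression. -/
def RExp.eval (m : Memory) : RExp → ℝ
  | .zero => 0
  | .one => 1
  | .read x i k => m.real x (i.eval m) (k.eval m)
  | .add a b => a.eval m + b.eval m
  | .sub a b => a.eval m - b.eval m

/-- Number of operations in the evaluation of an expression. -/
def RExp.cost : RExp → ℕ
  | .zero => 1
  | .one => 1
  | .read _ i k => i.cost + k.cost + 1
  | .add a b => a.cost + b.cost + 1
  | .sub a b => a.cost + b.cost + 1

/-- Tests. -/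
inductive Test : Type
  | natLt (a b : NExp)
  | realLt (a b : RExp)
  | not (c : Test)
  | and (c d : Test)

/-- Truth of a test. -/
def Test.Holds (m : Memory) : Test → Prop
  | .natLt a b => a.eval m < b.eval m
  | .realLt a b => a.eval m < b.eval m
  | .not c => ¬ c.Holds m
  | .and c d => c.Holds m ∧ d.Holds m

/-- Number of operations in the evaluation of a test. -/
def Test.cost : Test → ℕ
  | .natLt a b => a.cost + b.cost + 1
  | .realLt a b => a.cost + b.cost + 1
  | .not c => c.cost + 1
  | .and c d => c.cost + d.cost + 1

/-- Programs. -/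
inductive Program : Type
  | skip
  | setNat (x : ℕ) (i k : NExp) (e : NExp)
  | setReal (x : ℕ) (i k : NExp) (e : RExp)
  | seq (P Q : Program)
  | cond (c : Test) (P Q : Program)
  | loop (c : Test) (P : Program)

/-- `Runs P m m' t`: started on the memory `m`, the program `P` halts after exactly `t` time units
with the memory `m'`. Here `loop c P` repeats `P` as long as the test `c` holds. -/
inductive Runs : Program → Memory → Memory → ℕ → Prop
  | skip (m : Memory) : Runs .skip m m 1
  | setNat (m : Memory) (x : ℕ) (i k e : NExp) :
      Runs (.setNat x i k e) m
        { m with nat := update m.nat x (i.eval m) (k.eval m) (e.eval m) }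
        (i.cost + k.cost + e.cost + 1)
  | setReal (m : Memory) (x : ℕ) (i k : NExp) (e : RExp) :
      Runs (.setReal x i k e) m
        { m with real := update m.real x (i.eval m) (k.eval m) (e.eval m) }
        (i.cost + k.cost + e.cost + 1)
  | seq {P Q : Program} {m m₁ m₂ : Memory} {t₁ t₂ : ℕ}
      (hP : Runs P m m₁ t₁) (hQ : Runs Q m₁ m₂ t₂) : Runs (.seq P Q) m m₂ (t₁ + t₂)
  | condTrue {c : Test} {P Q : Program} {m m' : Memory} {t : ℕ}
      (hc : c.Holds m) (hP : Runs P m m' t) : Runs (.cond c P Q) m m' (c.cost + 1 + t)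
  | condFalse {c : Test} {P Q : Program} {m m' : Memory} {t : ℕ}
      (hc : ¬ c.Holds m) (hQ : Runs Q m m' t) : Runs (.cond c P Q) m m' (c.cost + 1 + t)
  | loopStop {c : Test} {P : Program} {m : Memory}
      (hc : ¬ c.Holds m) : Runs (.loop c P) m m (c.cost + 1)
  | loopStep {c : Test} {P : Program} {m m₁ m₂ : Memory} {t₁ t₂ : ℕ}
      (hc : c.Holds m) (hP : Runs P m m₁ t₁) (hQ : Runs (.loop c P) m₁ m₂ t₂) :
      Runs (.loop c P) m m₂ (c.cost + 1 + t₁ + t₂)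

/-- The machine is deterministic: the result and the running time are determined by the program
and the initial memory. -/
theorem Runs.deterministic {P : Program} {m m₁ m₂ : Memory} {t₁ t₂ : ℕ}
    (h₁ : Runs P m m₁ t₁) (h₂ : Runs P m m₂ t₂) : m₁ = m₂ ∧ t₁ = t₂ := by
  induction h₁ generalizing m₂ t₂ with
  | skip m => cases h₂; exact ⟨rfl, rfl⟩
  | setNat m x i k e => cases h₂; exact ⟨rfl, rfl⟩
  | setReal m x i k e => cases h₂; exact ⟨rfl, rfl⟩
  | seq hP hQ ihP ihQ =>
    cases h₂ with
    | seq hP' hQ' =>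
      obtain ⟨rfl, rfl⟩ := ihP hP'
      obtain ⟨rfl, rfl⟩ := ihQ hQ'
      exact ⟨rfl, rfl⟩
  | condTrue hc hP ih =>
    cases h₂ with
    | condTrue hc' hP' => obtain ⟨rfl, rfl⟩ := ih hP'; exact ⟨rfl, rfl⟩
    | condFalse hc' hQ' => exact absurd hc hc'
  | condFalse hc hQ ih =>
    cases h₂ with
    | condTrue hc' hP' => exact absurd hc' hc
    | condFalse hc' hQ' => obtain ⟨rfl, rfl⟩ := ih hQ'; exact ⟨rfl, rfl⟩
  | loopStop hc =>
    cases h₂ with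
    | loopStop hc' => exact ⟨rfl, rfl⟩
    | loopStep hc' hP' hQ' => exact absurd hc' hc
  | loopStep hc hP hQ ihP ihQ =>
    cases h₂ with
    | loopStop hc' => exact absurd hc hc'
    | loopStep hc' hP' hQ' =>
      obtain ⟨rfl, rfl⟩ := ihP hP'
      obtain ⟨rfl, rfl⟩ := ihQ hQ'
      exact ⟨rfl, rfl⟩

/-! ### Input and output conventions -/

namespace Instance

variable (I : Instance)

open Classical in
/-- The initial memory holding the instance `I`. Arrays of natural numbers: `0` and `1` hold the
numbers of sellers and buyers at `(0, 0)`; `2` and `3` hold the numbers of units of seller `s` and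
of buyer `b` at `(s, 0)` and `(b, 0)`; `4` is the adjacency matrix of the compatibility graph; `5`
holds the lower bound of buyer `b` at `(b, 0)`. Arrays of real numbers: `0` and `1` hold the values
of unit `i` of seller `s` and of unit `j` of buyer `b` at `(s, i)` and `(b, j)`. All other entries
are `0`. -/
def input : Memory where
  nat x p q :=
    match x with
    | 0 => if p = 0 ∧ q = 0 then I.nS else 0
    | 1 => if p = 0 ∧ q = 0 then I.nB else 0
    | 2 => if h : p < I.nS ∧ q = 0 then I.γS ⟨p, h.1⟩ else 0
    | 3 => if h : p < I.nB ∧ q = 0 then I.γB ⟨p, h.1⟩ else 0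
    | 4 => if ∃ (hp : p < I.nS) (hq : q < I.nB), I.compat ⟨p, hp⟩ ⟨q, hq⟩ then 1 else 0
    | 5 => if h : p < I.nB ∧ q = 0 then I.r ⟨p, h.1⟩ else 0
    | _ => 0
  real x p q :=
    match x with
    | 0 => if h : ∃ hp : p < I.nS, q < I.γS ⟨p, hp⟩ then (I.fS ⟨p, h.1⟩ ⟨q, h.2⟩ : ℝ) else 0
    | 1 => if h : ∃ hp : p < I.nB, q < I.γB ⟨p, hp⟩ then (I.fB ⟨p, h.1⟩ ⟨q, h.2⟩ : ℝ) else 0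
    | _ => 0

/-- The set of matched pairs written in the memory `m`: unit `i` of seller `s` is matched with
unit `j` of buyer `b` if the arrays `6` and `7` of natural numbers hold `b + 1` and `j + 1` at
`(s, i)`. -/
def output (m : Memory) : Finset (I.SUnit × I.BUnit) :=
  Finset.univ.filter fun p =>
    m.nat 6 p.1.1 p.1.2 = (p.2.1 : ℕ) + 1 ∧ m.nat 7 p.1.1 p.1.2 = (p.2.2 : ℕ) + 1

end Instance

end

end WaterTrading

/-!
The algorithm is an auction, and its correctness rests on linear programming duality.

*Reduction to matchings.* The units of sellers and buyers form a bipartite graph, with an edge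
between units that can be traded (`Tradable`). Since the weight of an edge is the value of the
buyer's unit minus the value of the seller's unit, optimality of a matching depends only on the
order of the values: if integral prices on the sellers' units clear the market for the ranks of the
units (`Clearing`), then applying a monotone function to ranks and prices gives clearing prices for
the true values (`Clearing.map`), and clearing prices are a dual certificate of maximality
(`Clearing.sum_le`). The order of the units may therefore be chosen (`Instance.key`) so as to
enforce the side conditions. Ties between units of an agent are broken in favour of earlier units,
which makes every matching with clearing prices valid (`Instance.isValid_of_clearing`). The first
`r b` units of a buyer `b` are placed above all other units; this is the order of the values after
adding a large bonus to these units, so that an optimal matching covers all of them whenever some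
feasible assignment exists (`Instance.optimal_of_clearing`).

*Finding clearing prices.* Ranks are multiplied by a scale exceeding the number of sellers' units,
and prices start at the costs. While some unmatched unit of a buyer has a neighbour with a price
below its value, it takes a cheapest neighbour, displacing the previous partner, and the price
increases by one (`AuctionState.bid`). Prices are bounded by the largest scaled rank, so the number
of bids is polynomial (`auction_spec`). In the end the prices clear the market up to an error of
`1`, because a matched unit was a cheapest neighbour before its price was last increased. Some
residue modulo the scale is not hit by any price, and rounding at this residue removes the error
(`Clearing.exists_rounding`).

*The machine.* Programs are verified with a Hoare logic for total correctness with time bounds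
(`Spec`), in which arrays not written by a program are known to be unchanged (`Frame`).
-/

namespace WaterTrading

/-! ### Reasoning about programs -/

/-- `Spec P m T Q`: started on the memory `m`, the program `P` halts within `T` time units, with a
memory satisfying `Q`. -/
def Spec (P : Program) (m : Memory) (T : ℕ) (Q : Memory → Prop) : Prop :=
  ∃ m' t, Runs P m m' t ∧ t ≤ T ∧ Q m'

theorem Spec.mono {P : Program} {m : Memory} {T T' : ℕ} {Q Q' : Memory → Prop}
    (h : Spec P m T Q) (hT : T ≤ T') (hQ : ∀ m', Q m' → Q' m') : Spec P m T' Q' := by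
  obtain ⟨m', t, hr, ht, hq⟩ := h
  exact ⟨m', t, hr, ht.trans hT, hQ _ hq⟩

theorem Spec.seq {P P' : Program} {m : Memory} {T T' : ℕ} {Q Q' : Memory → Prop}
    (h : Spec P m T Q) (h' : ∀ m', Q m' → Spec P' m' T' Q') :
    Spec (.seq P P') m (T + T') Q' := by
  obtain ⟨m₁, t₁, hr₁, ht₁, hq₁⟩ := h
  obtain ⟨m₂, t₂, hr₂, ht₂, hq₂⟩ := h' m₁ hq₁
  exact ⟨m₂, t₁ + t₂, .seq hr₁ hr₂, by omega, hq₂⟩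

/-- The arrays of natural numbers that a program may write to. -/
def Program.natWrites : Program → List ℕ
  | .skip => []
  | .setNat x _ _ _ => [x]
  | .setReal _ _ _ _ => []
  | .seq P Q => P.natWrites ++ Q.natWrites
  | .cond _ P Q => P.natWrites ++ Q.natWrites
  | .loop _ P => P.natWrites

/-- The arrays of real numbers that a program may write to. -/
def Program.realWrites : Program → List ℕ
  | .skip => []
  | .setNat _ _ _ _ => []
  | .setReal x _ _ _ => [x]
  | .seq P Q => P.realWrites ++ Q.realWrites
  | .cond _ P Q => P.realWrites ++ Q.realWrites
  | .loop _ P => P.realWrites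

/-- The memories `m` and `m'` agree on all arrays that `P` does not write to. -/
def Frame (P : Program) (m m' : Memory) : Prop :=
  (∀ x, x ∉ P.natWrites → m'.nat x = m.nat x) ∧ (∀ x, x ∉ P.realWrites → m'.real x = m.real x)

theorem Frame.refl (P : Program) (m : Memory) : Frame P m m := ⟨fun _ _ => rfl, fun _ _ => rfl⟩

theorem Frame.trans {P : Program} {m₁ m₂ m₃ : Memory} (h : Frame P m₁ m₂) (h' : Frame P m₂ m₃) :
    Frame P m₁ m₃ :=
  ⟨fun x hx => (h'.1 x hx).trans (h.1 x hx), fun x hx => (h'.2 x hx).trans (h.2 x hx)⟩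

theorem Frame.weaken {P Q : Program} {m m' : Memory} (h : Frame P m m')
    (h₁ : P.natWrites ⊆ Q.natWrites) (h₂ : P.realWrites ⊆ Q.realWrites) : Frame Q m m' :=
  ⟨fun x hx => h.1 x fun hx' => hx (h₁ hx'), fun x hx => h.2 x fun hx' => hx (h₂ hx')⟩

theorem Runs.frame {P : Program} {m m' : Memory} {t : ℕ} (h : Runs P m m' t) : Frame P m m' := by
  induction h with
  | skip m => exact Frame.refl _ _
  | setNat m x i k e =>
    refine ⟨fun y hy => ?_, fun _ _ => rfl⟩
    have : y ≠ x := by simpa [Program.natWrites] using hy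
    funext i' k'
    simp [update, this]
  | setReal m x i k e =>
    refine ⟨fun _ _ => rfl, fun y hy => ?_⟩
    have : y ≠ x := by simpa [Program.realWrites] using hy
    funext i' k'
    simp [update, this]
  | seq _ _ ihP ihQ =>
    exact (ihP.weaken (by simp [Program.natWrites]) (by simp [Program.realWrites])).trans
      (ihQ.weaken (by simp [Program.natWrites]) (by simp [Program.realWrites]))
  | condTrue _ _ ih => exact ih.weaken (by simp [Program.natWrites]) (by simp [Program.realWrites])
  | condFalse _ _ ih => exact ih.weaken (by simp [Program.natWrites]) (by simp [Program.realWrites])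
  | loopStop _ => exact Frame.refl _ _
  | loopStep _ _ _ ihP ihQ =>
    exact (ihP.weaken (by simp [Program.natWrites]) (by simp [Program.realWrites])).trans ihQ

theorem Spec.frame {P : Program} {m : Memory} {T : ℕ} {Q : Memory → Prop} (h : Spec P m T Q) :
    Spec P m T fun m' => Q m' ∧ Frame P m m' := by
  obtain ⟨m', t, hr, ht, hq⟩ := h
  exact ⟨m', t, hr, ht, hq, hr.frame⟩

open Classical in
/-- The memory after running a program without loops (loops are ignored). -/
noncomputable def Program.exec : Program → Memory → Memory
  | .skip, m => m
  | .setNat x i k e, m => { m with nat := update m.nat x (i.eval m) (k.eval m) (e.eval m) }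
  | .setReal x i k e, m => { m with real := update m.real x (i.eval m) (k.eval m) (e.eval m) }
  | .seq P Q, m => Q.exec (P.exec m)
  | .cond c P Q, m => if c.Holds m then P.exec m else Q.exec m
  | .loop _ _, m => m

/-- A bound for the running time of a program without loops: both branches of a conditional are
counted. -/
def Program.time : Program → ℕ
  | .skip => 1
  | .setNat _ i k e => i.cost + k.cost + e.cost + 1
  | .setReal _ i k e => i.cost + k.cost + e.cost + 1
  | .seq P Q => P.time + Q.time
  | .cond c P Q => c.cost + 1 + (P.time + Q.time)
  | .loop _ _ => 0

/-- The program contains no loops. -/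
def Program.LoopFree : Program → Prop
  | .skip => True
  | .setNat _ _ _ _ => True
  | .setReal _ _ _ _ => True
  | .seq P Q => P.LoopFree ∧ Q.LoopFree
  | .cond _ P Q => P.LoopFree ∧ Q.LoopFree
  | .loop _ _ => False

theorem Program.LoopFree.runs {P : Program} (h : P.LoopFree) (m : Memory) :
    ∃ t ≤ P.time, Runs P m (P.exec m) t := by
  induction P generalizing m with
  | skip => exact ⟨_, le_rfl, .skip m⟩
  | setNat x i k e => exact ⟨_, le_rfl, .setNat m x i k e⟩
  | setReal x i k e => exact ⟨_, le_rfl, .setReal m x i k e⟩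
  | seq P Q ihP ihQ =>
    obtain ⟨t₁, ht₁, hr₁⟩ := ihP h.1 m
    obtain ⟨t₂, ht₂, hr₂⟩ := ihQ h.2 (P.exec m)
    exact ⟨_, add_le_add ht₁ ht₂, .seq hr₁ hr₂⟩
  | cond c P Q ihP ihQ =>
    by_cases hc : c.Holds m
    · obtain ⟨t, ht, hr⟩ := ihP h.1 m
      refine ⟨c.cost + 1 + t, by simp only [Program.time]; omega, ?_⟩
      simpa only [Program.exec, if_pos hc] using Runs.condTrue hc hr
    · obtain ⟨t, ht, hr⟩ := ihQ h.2 m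
      refine ⟨c.cost + 1 + t, by simp only [Program.time]; omega, ?_⟩
      simpa only [Program.exec, if_neg hc] using Runs.condFalse hc hr
  | loop c P => exact h.elim

theorem Spec.of_loopFree {P : Program} (h : P.LoopFree) {m : Memory} {Q : Memory → Prop}
    (hQ : Q (P.exec m)) : Spec P m P.time Q := by
  obtain ⟨t, ht, hr⟩ := h.runs m
  exact ⟨_, t, hr, ht, hQ⟩

/-- The rule for loops with the invariant `Inv` and the variant `μ`. -/
theorem Spec.loop {c : Test} {P : Program} {T : ℕ} (Inv : Memory → Prop) (μ : Memory → ℕ)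
    (h : ∀ m, Inv m → c.Holds m → Spec P m T fun m' => Inv m' ∧ μ m' < μ m) (m : Memory)
    (hm : Inv m) :
    Spec (.loop c P) m (μ m * (c.cost + 1 + T) + (c.cost + 1))
      fun m' => Inv m' ∧ ¬ c.Holds m' := by
  induction hμ : μ m using Nat.strong_induction_on generalizing m with
  | _ n ih =>
    by_cases hc : c.Holds m
    · obtain ⟨m₁, t₁, hr₁, ht₁, hI, hlt⟩ := h m hm hc
      obtain ⟨m₂, t₂, hr₂, ht₂, hq⟩ := ih (μ m₁) (hμ ▸ hlt) m₁ hI rfl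
      refine ⟨m₂, _, .loopStep hc hr₁ hr₂, ?_, hq⟩
      have : (μ m₁ + 1) * (c.cost + 1 + T) ≤ n * (c.cost + 1 + T) :=
        Nat.mul_le_mul_right _ (by omega)
      rw [Nat.succ_mul] at this
      omega
    · exact ⟨m, _, .loopStop hc, by omega, hm, hc⟩

/-- Overwriting a scalar. -/
def Memory.set (m : Memory) (x a : ℕ) : Memory := { m with nat := update m.nat x 0 0 a }

/-- The scalar `x`. -/
abbrev NExp.sc (x : ℕ) : NExp := .read x (.const 0) (.const 0)

/-- The entry `k` of the one-dimensional array `x`. -/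
abbrev NExp.ent (x : ℕ) (k : NExp) : NExp := .read x k (.const 0)

/-- Increasing the scalar `x` by one. -/
abbrev Program.inc (x : ℕ) : Program := .setNat x (.const 0) (.const 0) (.add (.sc x) (.const 1))

/-- `for x < e do P`, where `P` changes neither the scalar `x` nor the value of `e`. -/
def Program.for (x : ℕ) (e : NExp) (P : Program) : Program :=
  .seq (.setNat x (.const 0) (.const 0) (.const 0)) (.loop (.natLt (.sc x) e) (.seq P (.inc x)))

/-- A bound for the running time of a `for` loop with upper limit `e` and at most `n` rounds of time
`T`. -/
def forTime (e : NExp) (n T : ℕ) : ℕ := 4 + (n * (e.cost + 5 + (T + 8)) + (e.cost + 5))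

theorem Frame.set_for {x : ℕ} {e : NExp} {P : Program} (m : Memory) (a : ℕ) :
    Frame (.for x e P) m (m.set x a) := by
  refine ⟨fun y hy => ?_, fun _ _ => rfl⟩
  have : y ≠ x := by
    rintro rfl
    simp [Program.for, Program.natWrites] at hy
  funext i k
  simp [Memory.set, update, this]

/-- The rule for `for` loops. The invariant may be used together with the fact that only the
arrays written by the loop have changed. -/
theorem Spec.for {x : ℕ} {e : NExp} {P : Program} {T : ℕ} (m₀ : Memory) (n B : ℕ) (hn : n ≤ B)
    (Inv : ℕ → Memory → Prop)
    (he : ∀ m, Frame (.for x e P) m₀ m → e.eval m = n)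
    (hx : x ∉ P.natWrites)
    (h₀ : Inv 0 (m₀.set x 0))
    (h : ∀ k < n, ∀ m, Frame (.for x e P) m₀ m → Inv k m → m.nat x 0 0 = k →
      Spec P m T fun m' => Inv (k + 1) (m'.set x (k + 1))) :
    Spec (.for x e P) m₀ (forTime e B T) fun m' => Inv n m' ∧ Frame (.for x e P) m₀ m' := by
  have hP : ∀ {m m'}, Frame P m m' → Frame (.for x e P) m m' := fun hF =>
    hF.weaken (by simp [Program.for, Program.natWrites]) (by simp [Program.for, Program.realWrites])
  have key := Spec.loop (c := .natLt (.sc x) e) (P := .seq P (.inc x)) (T := T + 8)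
    (fun m => Frame (.for x e P) m₀ m ∧ m.nat x 0 0 ≤ n ∧ Inv (m.nat x 0 0) m)
    (fun m => n - m.nat x 0 0)
    (by
      rintro m ⟨hF, hle, hI⟩ hc
      have hlt : m.nat x 0 0 < n := by simpa [Test.Holds, NExp.eval, he m hF] using hc
      refine Spec.seq (h _ hlt m hF hI rfl).frame ?_
      rintro m' ⟨hI', hF'⟩
      have hx' : m'.nat x = m.nat x := hF'.1 x hx
      have hset : (Program.inc x).exec m' = m'.set x (m.nat x 0 0 + 1) := by
        simp [Program.exec, NExp.eval, Memory.set, hx']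
      refine (Spec.of_loopFree (P := .inc x) trivial ?_)
      rw [hset]
      have h1 : (m'.set x (m.nat x 0 0 + 1)).nat x 0 0 = m.nat x 0 0 + 1 := by
        simp [Memory.set, update]
      refine ⟨⟨(hF.trans (hP hF')).trans (Frame.set_for _ _), ?_, ?_⟩, ?_⟩
      · rw [h1]; exact hlt
      · rw [h1]; exact hI'
      · simp only [h1]; omega)
    (m₀.set x 0) (by
      have h1 : (m₀.set x 0).nat x 0 0 = 0 := by simp [Memory.set, update]
      refine ⟨Frame.set_for _ _, ?_, ?_⟩
      · rw [h1]; exact Nat.zero_le _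
      · rw [h1]; exact h₀)
  have h1 : (m₀.set x 0).nat x 0 0 = 0 := by simp [Memory.set, update]
  simp only [h1, Nat.sub_zero, Test.cost, NExp.cost] at key
  have first : Spec (.setNat x (.const 0) (.const 0) (.const 0)) m₀ 4 fun m => m = m₀.set x 0 :=
    Spec.of_loopFree (P := .setNat x (.const 0) (.const 0) (.const 0)) trivial rfl
  refine (Spec.seq first (T' := n * (e.cost + 5 + (T + 8)) + (e.cost + 5))
    (Q' := fun m' => Inv n m' ∧ Frame (.for x e P) m₀ m') ?_).mono ?_ fun _ => id
  · rintro _ rfl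
    refine key.mono ?_ ?_
    · have : (1 + 1 + 1 + e.cost + 1 + 1 + (T + 8)) = (e.cost + 5 + (T + 8)) := by ring
      rw [this]; omega
    · rintro m' ⟨⟨hF, hle, hI⟩, hc⟩
      have : m'.nat x 0 0 = n := by
        have : ¬ m'.nat x 0 0 < n := by simpa [Test.Holds, NExp.eval, he m' hF] using hc
        omega
      exact ⟨this ▸ hI, hF⟩
  · have := Nat.mul_le_mul_right (e.cost + 5 + (T + 8)) hn
    simp only [forTime]; omega

/-! ### Optimality of matchings by linear programming duality -/

section Duality

variable {U V : Type*}

/-- Weak duality for maximum weight matchings, with complementary slackness: `y` and `z` are a dual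
solution for the edge weights `w v - c u`, tight on `T` and zero at the vertices missed by `T`. -/
theorem sum_le_sum_of_dual [Fintype U] [Fintype V] {E : U → V → Prop} {c : U → ℝ} {w : V → ℝ}
    {y : U → ℝ} {z : V → ℝ} {T T' : Finset (U × V)}
    (hT₁ : ∀ p ∈ T, ∀ q ∈ T, p.1 = q.1 → p = q) (hT₂ : ∀ p ∈ T, ∀ q ∈ T, p.2 = q.2 → p = q)
    (hT'₁ : ∀ p ∈ T', ∀ q ∈ T', p.1 = q.1 → p = q) (hT'₂ : ∀ p ∈ T', ∀ q ∈ T', p.2 = q.2 → p = q)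
    (hE : ∀ p ∈ T', E p.1 p.2)
    (hy : ∀ u, 0 ≤ y u) (hz : ∀ v, 0 ≤ z v)
    (hyz : ∀ u v, E u v → w v - c u ≤ y u + z v)
    (htight : ∀ p ∈ T, w p.2 - c p.1 = y p.1 + z p.2)
    (hy₀ : ∀ u, (∀ v, (u, v) ∉ T) → y u = 0) (hz₀ : ∀ v, (∀ u, (u, v) ∉ T) → z v = 0) :
    ∑ p ∈ T', (w p.2 - c p.1) ≤ ∑ p ∈ T, (w p.2 - c p.1) := by
  classical
  have i₁ : Set.InjOn Prod.fst (T : Set (U × V)) := fun p hp q hq h => hT₁ p hp q hq h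
  have i₂ : Set.InjOn Prod.snd (T : Set (U × V)) := fun p hp q hq h => hT₂ p hp q hq h
  have i'₁ : Set.InjOn Prod.fst (T' : Set (U × V)) := fun p hp q hq h => hT'₁ p hp q hq h
  have i'₂ : Set.InjOn Prod.snd (T' : Set (U × V)) := fun p hp q hq h => hT'₂ p hp q hq h
  calc ∑ p ∈ T', (w p.2 - c p.1) ≤ ∑ p ∈ T', (y p.1 + z p.2) :=
        Finset.sum_le_sum fun p hp => hyz _ _ (hE p hp)
    _ = ∑ u ∈ T'.image Prod.fst, y u + ∑ v ∈ T'.image Prod.snd, z v := by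
        rw [Finset.sum_add_distrib, Finset.sum_image i'₁, Finset.sum_image i'₂]
    _ ≤ ∑ u, y u + ∑ v, z v :=
        add_le_add (Finset.sum_le_univ_sum_of_nonneg hy) (Finset.sum_le_univ_sum_of_nonneg hz)
    _ = ∑ u ∈ T.image Prod.fst, y u + ∑ v ∈ T.image Prod.snd, z v := by
        congr 1 <;> symm <;> refine Finset.sum_subset (Finset.subset_univ _) ?_
        · intro u _ hu
          exact hy₀ u fun v hv => hu (Finset.mem_image.2 ⟨_, hv, rfl⟩)
        · intro v _ hv
          exact hz₀ v fun u hu => hv (Finset.mem_image.2 ⟨_, hu, rfl⟩)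
    _ = ∑ p ∈ T, (y p.1 + z p.2) := by
        rw [Finset.sum_add_distrib, Finset.sum_image i₁, Finset.sum_image i₂]
    _ = ∑ p ∈ T, (w p.2 - c p.1) := Finset.sum_congr rfl fun p hp => (htight p hp).symm

/-- `π` is a system of market clearing prices for the matching `T` in the graph `E`, up to the error
`ε`, when the costs are `c` and the values are `w`: every buyer is matched to a cheapest of her
neighbours, at a price not above her value, and an unmatched buyer can afford none of them; a price
is at least the cost, with equality at an unmatched vertex. -/
structure Clearing {R : Type*} [Add R] [LE R] (ε : R) (E : U → V → Prop) (T : Finset (U × V))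
    (c : U → R) (w : V → R) (π : U → R) : Prop where
  cost_le : ∀ u, c u ≤ π u
  eq_cost : ∀ u, (∀ v, (u, v) ∉ T) → π u = c u
  le_value : ∀ u v, (u, v) ∈ T → π u ≤ w v
  cheapest : ∀ u v u', (u, v) ∈ T → E u' v → π u ≤ π u' + ε
  value_le : ∀ v, (∀ u, (u, v) ∉ T) → ∀ u, E u v → w v ≤ π u

/-- A matching supported by market clearing prices has maximum weight. -/
theorem Clearing.sum_le [Fintype U] [Fintype V] {E : U → V → Prop} {c : U → ℝ} {w : V → ℝ}
    {π : U → ℝ} {T T' : Finset (U × V)} (h : Clearing 0 E T c w π)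
    (hT₁ : ∀ p ∈ T, ∀ q ∈ T, p.1 = q.1 → p = q) (hT₂ : ∀ p ∈ T, ∀ q ∈ T, p.2 = q.2 → p = q)
    (hT'₁ : ∀ p ∈ T', ∀ q ∈ T', p.1 = q.1 → p = q) (hT'₂ : ∀ p ∈ T', ∀ q ∈ T', p.2 = q.2 → p = q)
    (hE : ∀ p ∈ T', E p.1 p.2) :
    ∑ p ∈ T', (w p.2 - c p.1) ≤ ∑ p ∈ T, (w p.2 - c p.1) := by
  classical
  -- the surplus of a buyer is her value minus the price of her partner
  let z : V → ℝ := fun v => if hv : ∃ u, (u, v) ∈ T then w v - π hv.choose else 0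
  have hzT : ∀ u v, (u, v) ∈ T → z v = w v - π u := by
    intro u v huv
    have hv : ∃ u, (u, v) ∈ T := ⟨u, huv⟩
    have : hv.choose = u := congrArg Prod.fst (hT₂ _ hv.choose_spec _ huv rfl)
    simp only [z, dif_pos hv, this]
  have hz₀ : ∀ v, (∀ u, (u, v) ∉ T) → z v = 0 := fun v hv => by
    simp only [z]
    rw [dif_neg (by simpa using hv)]
  refine sum_le_sum_of_dual (y := fun u => π u - c u) (z := z) hT₁ hT₂ hT'₁ hT'₂ hE
    (fun u => sub_nonneg.2 (h.cost_le u)) ?_ ?_ ?_ (fun u hu => sub_eq_zero.2 (h.eq_cost u hu)) hz₀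
  · intro v
    by_cases hv : ∃ u, (u, v) ∈ T
    · obtain ⟨u, hu⟩ := hv
      rw [hzT u v hu]
      exact sub_nonneg.2 (h.le_value u v hu)
    · rw [hz₀ v (by simpa using hv)]
  · intro u v huv
    by_cases hv : ∃ u, (u, v) ∈ T
    · obtain ⟨u', hu'⟩ := hv
      have := h.cheapest u' v u hu' huv
      rw [hzT u' v hu']
      linarith
    · have hv' : ∀ u, (u, v) ∉ T := by simpa using hv
      have := h.value_le v hv' u huv
      rw [hz₀ v hv']
      linarith
  · rintro ⟨u, v⟩ hp
    rw [hzT u v hp]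
    ring

/-- If costs and values are multiples of a scale larger than the number of sellers, the error `1` of
integral prices can be removed by rounding: some residue is not hit by any price, and prices are
rounded to multiples of the scale with this residue as the threshold. -/
theorem Clearing.exists_rounding [Fintype U] {E : U → V → Prop} {c : U → ℕ} {w : V → ℕ} {p : U → ℕ}
    {T : Finset (U × V)} {D : ℕ} (hD : Fintype.card U + 2 ≤ D)
    (h : Clearing 1 E T (fun u => D * c u) (fun v => D * w v) p) :
    ∃ π : U → ℕ, Clearing 0 E T c w π := by
  classical
  obtain ⟨δ, hδ, hδp⟩ : ∃ δ ∈ Finset.Ico 1 D, δ ∉ Finset.univ.image fun u => p u % D := by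
    -- there are `D - 1` candidates, more than prices
    by_contra! hcon
    have := (Finset.card_le_card (t := Finset.univ.image fun u => p u % D)
      (fun δ hδ => hcon δ hδ)).trans Finset.card_image_le
    rw [Nat.card_Ico, Finset.card_univ] at this
    omega
  have hδ' := Finset.mem_Ico.1 hδ
  have hδp' : ∀ u, p u % D ≠ δ := by simpa using hδp
  have hmul : ∀ a, (D * a + (D - δ)) / D = a := fun a => by
    rw [Nat.mul_add_div (by omega), Nat.div_eq_of_lt (by omega), add_zero]
  have hmono : ∀ a b, a ≤ b → (a + (D - δ)) / D ≤ (b + (D - δ)) / D := fun a b hab =>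
    Nat.div_le_div_right (by omega)
  refine ⟨fun u => (p u + (D - δ)) / D, ?_, ?_, ?_, ?_, ?_⟩
  · intro u
    simpa only [hmul] using hmono _ _ (h.cost_le u)
  · intro u hu
    simp only [h.eq_cost u hu, hmul]
  · intro u v huv
    simpa only [hmul] using hmono _ _ (h.le_value u v huv)
  · intro u v u' huv hE
    rcases (h.cheapest u v u' huv hE).lt_or_eq with hlt | heq
    · exact hmono _ _ (by omega)
    -- a rounded price can only jump at the residue `δ`, which `p u` avoids
    · show (p u + (D - δ)) / D ≤ (p u' + (D - δ)) / D
      have hnd : ¬ D ∣ (p u' + (D - δ)) + 1 := by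
        intro hd
        refine hδp' u ?_
        obtain ⟨e, he⟩ := hd
        have hp : p u + D = D * e + δ := by omega
        have := congrArg (· % D) hp
        simpa [Nat.mod_eq_of_lt hδ'.2] using this
      rw [heq, show p u' + 1 + (D - δ) = (p u' + (D - δ)) + 1 by ring, Nat.succ_div, if_neg hnd]
      rfl
  · intro v hv u hE
    simpa only [hmul] using hmono _ _ (h.value_le v hv u hE)

/-- Market clearing prices survive a monotone change of the scale on which costs, values and prices
are measured. -/
theorem Clearing.map {E : U → V → Prop} {c : U → ℕ} {w : V → ℕ} {π : U → ℕ}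
    {T : Finset (U × V)} (h : Clearing 0 E T c w π) {g : ℕ → ℝ} (hg : Monotone g) :
    Clearing 0 E T (fun u => g (c u)) (fun v => g (w v)) (fun u => g (π u)) where
  cost_le u := hg (h.cost_le u)
  eq_cost u hu := by rw [h.eq_cost u hu]
  le_value u v huv := hg (h.le_value u v huv)
  cheapest u v u' huv hE := by
    rw [add_zero]; exact hg (by simpa using h.cheapest u v u' huv hE)
  value_le v hv u hE := hg (h.value_le v hv u hE)

end Duality

/-! ### From clearing prices to optimal feasible assignments -/

namespace Instance

variable {I : Instance}

/-- Unit `u` of a seller may be traded for unit `v` of a buyer. -/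
def Tradable (u : I.SUnit) (v : I.BUnit) : Prop :=
  I.compat u.1 v.1 ∧ I.fS u.1 u.2 ≤ I.fB v.1 v.2

open Classical in
/-- `1` for a unit of a buyer that has to be matched because of her lower bound, and `0` for all
other units. -/
noncomputable def mandatory : I.SUnit ⊕ I.BUnit → ℕ
  | .inl _ => 0
  | .inr v => if (v.2 : ℕ) < I.r v.1 then 1 else 0

/-- The value of a unit. -/
noncomputable def value : I.SUnit ⊕ I.BUnit → ℝ≥0
  | .inl u => I.fS u.1 u.2
  | .inr v => I.fB v.1 v.2

/-- Among units of the same value, earlier units of a seller count as cheaper, and earlier units of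
a buyer as more valuable. -/
def tie : I.SUnit ⊕ I.BUnit → ℕ
  | .inl u => u.2
  | .inr v => I.γB v.1 - v.2

/-- The position of a unit in the order of all units: mandatory units come last, other units are
ordered by value, and ties are broken. -/
noncomputable def key (x : I.SUnit ⊕ I.BUnit) : ℕ ×ₗ (ℝ ×ₗ ℕ) :=
  toLex (mandatory x, toLex ((value x : ℝ), tie x))

/-- A number exceeding all values and all welfares, used as a bonus for mandatory units. -/
noncomputable def bonus (I : Instance) : ℝ≥0 :=
  1 + ∑ x : I.SUnit ⊕ I.BUnit, value x

/-- The value of a unit together with the bonus for mandatory units. -/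
noncomputable def boosted (x : I.SUnit ⊕ I.BUnit) : ℝ≥0 := value x + I.bonus * mandatory x

theorem mandatory_le_one (x : I.SUnit ⊕ I.BUnit) : mandatory x ≤ 1 := by
  rcases x with u | v
  · simp [mandatory]
  · simp only [mandatory]; split_ifs <;> simp

theorem value_le_bonus (x : I.SUnit ⊕ I.BUnit) : value x ≤ I.bonus :=
  (Finset.single_le_sum (f := value) (fun _ _ => zero_le) (Finset.mem_univ x)).trans
    (le_add_of_nonneg_left zero_le)

/-- The order of the units refines the order of the boosted values, because the bonus exceeds the
value of every unit. -/
theorem boosted_le_of_key_le {x y : I.SUnit ⊕ I.BUnit} (h : key x ≤ key y) :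
    boosted x ≤ boosted y := by
  rw [key, key, Prod.Lex.toLex_le_toLex, Prod.Lex.toLex_le_toLex] at h
  rcases h with h | ⟨h, h'⟩
  · have hx : mandatory x = 0 := by have := mandatory_le_one y; simp only at h; omega
    have hy : mandatory y = 1 := by have := mandatory_le_one y; simp only at h; omega
    rw [boosted, boosted, hx, hy]
    simpa using (value_le_bonus x).trans (le_add_of_nonneg_left zero_le)
  · simp only at h h'
    have : value x ≤ value y := by
      rcases h' with h' | ⟨h', -⟩
      · exact_mod_cast h'.le
      · exact (NNReal.coe_injective h').le
    rw [boosted, boosted, h]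
    gcongr

theorem key_seller_lt (hI : I.MonotoneValues) (s : Fin I.nS) {i i' : Fin (I.γS s)} (h : i' < i) :
    key (I := I) (.inl ⟨s, i'⟩) < key (I := I) (.inl ⟨s, i⟩) := by
  have h1 : I.fS s i' ≤ I.fS s i := hI.1 s h.le
  rw [key, key, Prod.Lex.toLex_lt_toLex, Prod.Lex.toLex_lt_toLex]
  refine Or.inr ⟨rfl, ?_⟩
  rcases h1.lt_or_eq with h1 | h1
  · exact Or.inl (by simpa [value] using h1)
  · exact Or.inr ⟨by simp [value, h1], h⟩

theorem key_buyer_lt (hI : I.MonotoneValues) (b : Fin I.nB) {j j' : Fin (I.γB b)} (h : j' < j) :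
    key (I := I) (.inr ⟨b, j⟩) < key (I := I) (.inr ⟨b, j'⟩) := by
  have h1 : I.fB b j ≤ I.fB b j' := hI.2 b h.le
  have h2 : (j' : ℕ) < j := h
  rw [key, key, Prod.Lex.toLex_lt_toLex, Prod.Lex.toLex_lt_toLex]
  simp only [mandatory]
  by_cases hj : (j : ℕ) < I.r b
  · have hj' : (j' : ℕ) < I.r b := by omega
    refine Or.inr ⟨by simp [hj, hj'], ?_⟩
    rcases h1.lt_or_eq with h1 | h1
    · exact Or.inl (by simpa [value] using h1)
    · exact Or.inr ⟨by simp [value, h1], by simp only [tie]; omega⟩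
  · by_cases hj' : (j' : ℕ) < I.r b
    · exact Or.inl (by simp [hj, hj'])
    · refine Or.inr ⟨by simp [hj, hj'], ?_⟩
      rcases h1.lt_or_eq with h1 | h1
      · exact Or.inl (by simpa [value] using h1)
      · exact Or.inr ⟨by simp [value, h1], by simp only [tie]; omega⟩

theorem isAssignment_of_tradable {T : Finset (I.SUnit × I.BUnit)}
    (hT₁ : ∀ p ∈ T, ∀ q ∈ T, p.1 = q.1 → p = q) (hT₂ : ∀ p ∈ T, ∀ q ∈ T, p.2 = q.2 → p = q)
    (hE : ∀ p ∈ T, Tradable p.1 p.2) : IsAssignment T :=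
  ⟨fun p hp => (hE p hp).1, hT₁, hT₂⟩

/-- Clearing prices for tie-breaking costs and values force every agent to trade her first units:
a skipped earlier unit of a seller is cheaper, and a skipped earlier unit of a buyer can afford
more. -/
theorem isValid_of_clearing (hI : I.MonotoneValues) {T : Finset (I.SUnit × I.BUnit)}
    (hT₁ : ∀ p ∈ T, ∀ q ∈ T, p.1 = q.1 → p = q) (hT₂ : ∀ p ∈ T, ∀ q ∈ T, p.2 = q.2 → p = q)
    (hE : ∀ p ∈ T, Tradable p.1 p.2) {rk : I.SUnit ⊕ I.BUnit → ℕ}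
    (hrk : ∀ x y, rk x ≤ rk y ↔ key x ≤ key y) {π : I.SUnit → ℕ}
    (h : Clearing 0 Tradable T (fun u => rk (.inl u)) (fun v => rk (.inr v)) π) : IsValid T := by
  have hlt : ∀ {x y}, key x < key y → rk x < rk y := fun {x y} hxy => by
    rw [← not_le, hrk, not_le]; exact hxy
  refine ⟨isAssignment_of_tradable hT₁ hT₂ hE, fun p hp => (hE p hp).2, ?_, ?_⟩
  · rintro s i i' hi ⟨v, hv⟩
    have hi' : i' < i := by rw [Fin.lt_def]; omega
    by_contra hcon
    have hun : ∀ v, ((⟨s, i'⟩ : I.SUnit), v) ∉ T := fun v' h' => hcon ⟨v', h'⟩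
    have htr : Tradable (⟨s, i'⟩ : I.SUnit) v :=
      ⟨(hE _ hv).1, (hI.1 s hi'.le).trans (hE _ hv).2⟩
    have h1 := h.cheapest _ _ _ hv htr
    have h2 := h.eq_cost _ hun
    have h3 := h.cost_le ⟨s, i⟩
    have h4 := hlt (key_seller_lt hI s hi')
    omega
  · rintro b j j' hj ⟨u, hu⟩
    have hj' : j' < j := by rw [Fin.lt_def]; omega
    by_contra hcon
    have hun : ∀ u, (u, (⟨b, j'⟩ : I.BUnit)) ∉ T := fun u' h' => hcon ⟨u', h'⟩
    have htr : Tradable u (⟨b, j'⟩ : I.BUnit) :=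
      ⟨(hE _ hu).1, (hE _ hu).2.trans (hI.2 b hj'.le)⟩
    have h1 := h.value_le _ hun _ htr
    have h2 := h.le_value _ _ hu
    have h3 := hlt (key_buyer_lt hI b hj')
    omega

/-- Clearing prices with respect to the order of the units make a matching optimal for the values
with the bonus. -/
theorem boosted_le_of_clearing {T T' : Finset (I.SUnit × I.BUnit)}
    (hT₁ : ∀ p ∈ T, ∀ q ∈ T, p.1 = q.1 → p = q) (hT₂ : ∀ p ∈ T, ∀ q ∈ T, p.2 = q.2 → p = q)
    {rk : I.SUnit ⊕ I.BUnit → ℕ} (hrk : ∀ x y, rk x ≤ rk y ↔ key x ≤ key y) {π : I.SUnit → ℕ}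
    (h : Clearing 0 Tradable T (fun u => rk (.inl u)) (fun v => rk (.inr v)) π)
    (hT' : IsValid T') :
    ∑ p ∈ T', ((boosted (I := I) (.inr p.2) : ℝ) - boosted (I := I) (.inl p.1)) ≤
      ∑ p ∈ T, ((boosted (I := I) (.inr p.2) : ℝ) - boosted (I := I) (.inl p.1)) := by
  classical
  -- a monotone function that turns ranks into boosted values
  let g : ℕ → ℝ≥0 := fun k => (Finset.univ.filter fun x => rk x ≤ k).sup boosted
  have hg : Monotone fun k => (g k : ℝ) := fun a b hab =>
    NNReal.coe_le_coe.2 (Finset.sup_mono fun x hx => by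
      simp only [Finset.mem_filter, Finset.mem_univ, true_and] at hx ⊢; omega)
  have hgrk : ∀ x, g (rk x) = boosted x := fun x => by
    refine le_antisymm (Finset.sup_le fun y hy => ?_) (Finset.le_sup (by simp))
    exact boosted_le_of_key_le ((hrk y x).1 (by simpa using hy))
  have hc := h.map hg
  simp only [hgrk] at hc
  exact hc.sum_le hT₁ hT₂ hT'.1.2.1 hT'.1.2.2 fun p hp => ⟨hT'.1.1 p hp, hT'.2.1 p hp⟩

theorem BMatched.of_le {T : Finset (I.SUnit × I.BUnit)} (hT : IsValid T) {b : Fin I.nB}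
    {j : Fin (I.γB b)} (h : BMatched T ⟨b, j⟩) (j' : Fin (I.γB b)) (hj : j' ≤ j) :
    BMatched T ⟨b, j'⟩ := by
  obtain ⟨d, hd⟩ := Nat.exists_eq_add_of_le (Fin.le_def.1 hj)
  induction d generalizing j' with
  | zero =>
    have : j = j' := Fin.ext (by omega)
    exact this ▸ h
  | succ d ih =>
    have hlt := j.isLt
    exact hT.2.2.2 b ⟨j' + 1, by omega⟩ j' rfl
      (ih ⟨j' + 1, by omega⟩ (by rw [Fin.le_def]; simp only; omega) (by simp only; omega))

theorem assigned_eq_card {T : Finset (I.SUnit × I.BUnit)} (hT : IsAssignment T) (b : Fin I.nB) :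
    assigned T b = {j : Fin (I.γB b) | BMatched T ⟨b, j⟩}.ncard := by
  classical
  have : {j : Fin (I.γB b) | BMatched T ⟨b, j⟩} =
      ((T.filter fun p => p.2.1 = b).attach.image fun p =>
        Fin.cast (congrArg I.γB (by simpa using (Finset.mem_filter (s := T).1 p.2).2))
          p.1.2.2 : Finset (Fin (I.γB b))) := by
    ext j
    simp only [Set.mem_ofPred_eq, Finset.coe_image, Set.mem_image, Finset.mem_coe,
      Finset.mem_attach, true_and]
    constructor
    · rintro ⟨u, hu⟩
      exact ⟨⟨(u, ⟨b, j⟩), by simp [hu]⟩, rfl⟩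
    · rintro ⟨⟨⟨u, ⟨b', j'⟩⟩, hp⟩, rfl⟩
      obtain ⟨hp', rfl⟩ := Finset.mem_filter.1 hp
      exact ⟨u, hp'⟩
  rw [this, Set.ncard_coe_finset, Finset.card_image_of_injective, Finset.card_attach, assigned]
  rintro ⟨⟨u, ⟨b₁, j₁⟩⟩, hp⟩ ⟨⟨u', ⟨b₂, j₂⟩⟩, hq⟩ h
  obtain ⟨hp', rfl⟩ := Finset.mem_filter.1 hp
  obtain ⟨hq', h2⟩ := Finset.mem_filter.1 hq
  obtain rfl : b₂ = b₁ := h2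
  obtain rfl : j₁ = j₂ := h
  exact Subtype.ext (hT.2.2 _ hp' _ hq' rfl)

/-- A valid assignment meets the lower bounds if and only if it covers the mandatory units, provided
the lower bounds do not exceed the numbers of units. -/
theorem le_assigned_iff {T : Finset (I.SUnit × I.BUnit)} (hT : IsValid T) (b : Fin I.nB) :
    I.r b ≤ assigned T b ↔
      I.r b ≤ I.γB b ∧ ∀ j : Fin (I.γB b), (j : ℕ) < I.r b → BMatched T ⟨b, j⟩ := by
  classical
  rw [assigned_eq_card hT.1]
  constructor
  · intro h
    refine ⟨h.trans ((Set.ncard_le_card _).trans (by simp)), fun j hj => ?_⟩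
    by_contra hcon
    have hsub : {j : Fin (I.γB b) | BMatched T ⟨b, j⟩} ⊆ Set.Iio j := by
      intro j' hj'
      by_contra hlt
      exact hcon (BMatched.of_le hT hj' j (not_lt.1 hlt))
    have := Set.ncard_le_ncard hsub
    rw [← Finset.coe_Iio, Set.ncard_coe_finset, Fin.card_Iio] at this
    omega
  · rintro ⟨h, h'⟩
    have hsub : Set.range (fun k : Fin (I.r b) => (⟨k, by omega⟩ : Fin (I.γB b))) ⊆
        {j : Fin (I.γB b) | BMatched T ⟨b, j⟩} := by
      rintro _ ⟨k, rfl⟩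
      exact h' _ k.isLt
    have := Set.ncard_le_ncard hsub
    rwa [← Set.image_univ, Set.ncard_image_of_injective _
      (fun k k' hk => Fin.ext (by simpa using hk)), Set.ncard_univ, Nat.card_fin] at this

/-- The number of mandatory units covered by `T`. -/
noncomputable def covered (T : Finset (I.SUnit × I.BUnit)) : ℕ :=
  ∑ p ∈ T, mandatory (I := I) (.inr p.2)

theorem sum_boosted (T : Finset (I.SUnit × I.BUnit)) :
    ∑ p ∈ T, ((boosted (I := I) (.inr p.2) : ℝ) - boosted (I := I) (.inl p.1)) =
      welfare T + I.bonus * covered T := by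
  simp only [boosted, value, welfare, covered, Nat.cast_sum, Finset.mul_sum,
    ← Finset.sum_add_distrib]
  refine Finset.sum_congr rfl fun p _ => ?_
  have : mandatory (I := I) (.inl p.1) = 0 := rfl
  rw [this]
  push_cast
  ring

theorem covered_le {T : Finset (I.SUnit × I.BUnit)} (hT : IsAssignment T) :
    covered T ≤ ∑ v : I.BUnit, mandatory (I := I) (.inr v) := by
  classical
  rw [covered, ← Finset.sum_image (s := T) (g := Prod.snd)
    (f := fun v => mandatory (I := I) (.inr v)) fun p hp q hq => hT.2.2 p hp q hq]
  exact Finset.sum_le_univ_sum_of_nonneg fun _ => Nat.zero_le _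

theorem le_covered {T : Finset (I.SUnit × I.BUnit)}
    (h : ∀ v : I.BUnit, mandatory (I := I) (.inr v) = 1 → BMatched T v) :
    ∑ v : I.BUnit, mandatory (I := I) (.inr v) ≤ covered T := by
  classical
  calc ∑ v : I.BUnit, mandatory (I := I) (.inr v)
      = ∑ v ∈ T.image Prod.snd, mandatory (I := I) (.inr v) := by
        symm
        refine Finset.sum_subset (Finset.subset_univ _) fun v _ hv => ?_
        by_contra h0
        have h1 := mandatory_le_one (I := I) (.inr v)
        obtain ⟨u, hu⟩ := h v (by omega)
        exact hv (Finset.mem_image.2 ⟨_, hu, rfl⟩)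
    _ ≤ _ := Finset.sum_image_le_of_nonneg fun _ _ => Nat.zero_le _

theorem BMatched.of_le_covered {T : Finset (I.SUnit × I.BUnit)} (hT : IsAssignment T)
    (h : ∑ v : I.BUnit, mandatory (I := I) (.inr v) ≤ covered T) {v : I.BUnit}
    (hv : mandatory (I := I) (.inr v) = 1) : BMatched T v := by
  classical
  by_contra hcon
  refine h.not_gt ?_
  rw [covered, ← Finset.sum_image (s := T) (g := Prod.snd)
    (f := fun v => mandatory (I := I) (.inr v)) fun p hp q hq => hT.2.2 p hp q hq]
  refine Finset.sum_lt_sum_of_subset (Finset.subset_univ _) (Finset.mem_univ v) ?_ (by omega)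
    fun _ _ _ => Nat.zero_le _
  intro hmem
  obtain ⟨⟨u, v'⟩, hp, rfl⟩ := Finset.mem_image.1 hmem
  exact hcon ⟨u, hp⟩

/-- Feasibility of a valid assignment means that it covers all mandatory units. -/
theorem isFeasible_iff {T : Finset (I.SUnit × I.BUnit)} (hT : IsValid T)
    (hr : ∀ b, I.r b ≤ I.γB b) :
    IsFeasible T ↔ ∑ v : I.BUnit, mandatory (I := I) (.inr v) ≤ covered T := by
  constructor
  · rintro ⟨-, h⟩
    refine le_covered ?_
    rintro ⟨b, j⟩ hv
    exact ((le_assigned_iff hT b).1 (h b)).2 j (by simpa [mandatory] using hv)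
  · intro h
    refine ⟨hT, fun b => (le_assigned_iff hT b).2 ⟨hr b, fun j hj => ?_⟩⟩
    exact .of_le_covered hT.1 h (by simp [mandatory, hj])

theorem welfare_nonneg {T : Finset (I.SUnit × I.BUnit)} (hT : IsValid T) : 0 ≤ welfare T :=
  Finset.sum_nonneg fun p hp => sub_nonneg.2 (NNReal.coe_le_coe.2 (hT.2.1 p hp))

theorem welfare_lt_bonus {T : Finset (I.SUnit × I.BUnit)} (hT : IsAssignment T) :
    welfare T < I.bonus := by
  classical
  have h1 : ∑ p ∈ T, I.fB p.2.1 p.2.2 ≤ ∑ x : I.SUnit ⊕ I.BUnit, value x := by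
    rw [Fintype.sum_sum_type]
    refine le_trans ?_ (le_add_of_nonneg_left zero_le)
    refine (Finset.sum_image (s := T) (g := Prod.snd) (f := fun v => value (I := I) (.inr v))
      fun p hp q hq => hT.2.2 p hp q hq).symm.le.trans ?_
    exact Finset.sum_le_univ_sum_of_nonneg fun _ => zero_le
  have h2 : welfare T ≤ (∑ p ∈ T, I.fB p.2.1 p.2.2 : ℝ≥0) := by
    rw [welfare, NNReal.coe_sum]
    exact Finset.sum_le_sum fun p _ => sub_le_self _ (NNReal.coe_nonneg _)
  have h3 : ((∑ p ∈ T, I.fB p.2.1 p.2.2 : ℝ≥0) : ℝ) ≤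
      (∑ x : I.SUnit ⊕ I.BUnit, value x : ℝ≥0) := NNReal.coe_le_coe.2 h1
  have h4 : (I.bonus : ℝ) = 1 + (∑ x : I.SUnit ⊕ I.BUnit, value x : ℝ≥0) := by
    rw [bonus, NNReal.coe_add, NNReal.coe_one]
  linarith

/-- A matching with clearing prices with respect to the order of the units is a feasible assignment
of maximum welfare: since the bonus exceeds every welfare, an optimal matching for the boosted
values covers all mandatory units. -/
theorem optimal_of_clearing (hI : I.MonotoneValues)
    (hfeas : ∃ T : Finset (I.SUnit × I.BUnit), IsFeasible T) {T : Finset (I.SUnit × I.BUnit)}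
    (hT₁ : ∀ p ∈ T, ∀ q ∈ T, p.1 = q.1 → p = q) (hT₂ : ∀ p ∈ T, ∀ q ∈ T, p.2 = q.2 → p = q)
    (hE : ∀ p ∈ T, Tradable p.1 p.2) {rk : I.SUnit ⊕ I.BUnit → ℕ}
    (hrk : ∀ x y, rk x ≤ rk y ↔ key x ≤ key y) {π : I.SUnit → ℕ}
    (h : Clearing 0 Tradable T (fun u => rk (.inl u)) (fun v => rk (.inr v)) π) :
    IsValid T ∧ (∀ b, I.r b ≤ assigned T b) ∧
      ∀ T' : Finset (I.SUnit × I.BUnit), IsFeasible T' → welfare T' ≤ welfare T := by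
  have hval := isValid_of_clearing hI hT₁ hT₂ hE hrk h
  have hr : ∀ b, I.r b ≤ I.γB b := fun b => by
    obtain ⟨T', hT'⟩ := hfeas
    exact ((le_assigned_iff hT'.1 b).1 (hT'.2 b)).1
  have hopt : ∀ T' : Finset (I.SUnit × I.BUnit), IsValid T' →
      welfare T' + I.bonus * covered T' ≤ welfare T + I.bonus * covered T := fun T' hT' => by
    have := boosted_le_of_clearing hT₁ hT₂ hrk h hT'
    rwa [sum_boosted, sum_boosted] at this
  have hcov : ∑ v : I.BUnit, mandatory (I := I) (.inr v) ≤ covered T := by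
    obtain ⟨T', hT'⟩ := hfeas
    refine ((isFeasible_iff hT'.1 hr).1 hT').trans ?_
    by_contra! hlt
    -- one more mandatory unit would be worth more than all values together
    have h1 := hopt T' hT'.1
    have h2 : ((covered T : ℝ) + 1) ≤ covered T' := by exact_mod_cast hlt
    have h3 := mul_le_mul_of_nonneg_left h2 (NNReal.coe_nonneg I.bonus)
    linarith [welfare_nonneg hT'.1, welfare_lt_bonus hval.1]
  refine ⟨hval, ((isFeasible_iff hval hr).2 hcov).2, fun T' hT' => ?_⟩
  have heq : covered T' = covered T :=
    le_antisymm ((covered_le hT'.1.1).trans hcov)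
      ((covered_le hval.1).trans ((isFeasible_iff hT'.1 hr).1 hT'))
  have := hopt T' hT'.1
  rw [heq] at this
  linarith

end Instance

/-! ### The program

Besides the arrays of the input and the output, the program uses the following arrays of natural
numbers. The units are numbered from `0`, sellers' units first.

* `8`: the number of units; `9`: the number of sellers' units;
* `10`, `11`, `20`: loop counters;
* `12`, `13`: agent and position of unit `k` at `(k, 0)`;
* `14`, `15`: tie-breaking number of unit `k`, and whether it is mandatory, at `(k, 0)`;
* `16`: the scale of the prices;
* `17`: at `(k, 0)` the current price of the seller's unit `k`, or the value of the buyer's unit `k`;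
* `18`: at `(k, 0)` the partner of unit `k`, plus one, or `0` if the unit is unmatched;
* `19`: the unit of a buyer considered at present;
* `21`, `22`: the least price found so far and the unit having this price, plus one.

The array `2` of real numbers holds the value of unit `k` at `(k, 0)`. -/

/-- Give the next number to unit number `11` of agent number `10`. -/
def flattenBody : Program :=
  .seq (.setNat 12 (.sc 8) (.const 0) (.sc 10)) <|
  .seq (.setNat 13 (.sc 8) (.const 0) (.sc 11)) (.inc 8)

/-- Number the units of all agents of one side. The array `x` holds the number of agents, and `y`
their numbers of units. -/
def flatten (x y : ℕ) : Program :=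
  .for 10 (.sc x) <| .for 11 (.ent y (.sc 10)) flattenBody

/-- Collect value, tie-breaking number and mandatoriness of unit number `10`. -/
def attributesBody : Program :=
  .cond (.natLt (.sc 10) (.sc 9))
    (.seq (.setReal 2 (.sc 10) (.const 0) (.read 0 (.ent 12 (.sc 10)) (.ent 13 (.sc 10)))) <|
     .seq (.setNat 14 (.sc 10) (.const 0) (.ent 13 (.sc 10)))
      (.setNat 15 (.sc 10) (.const 0) (.const 0)))
    (.seq (.setReal 2 (.sc 10) (.const 0) (.read 1 (.ent 12 (.sc 10)) (.ent 13 (.sc 10)))) <|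
     .seq (.setNat 14 (.sc 10) (.const 0)
        (.sub (.ent 3 (.ent 12 (.sc 10))) (.ent 13 (.sc 10))))
      (.cond (.natLt (.ent 13 (.sc 10)) (.ent 5 (.ent 12 (.sc 10))))
        (.setNat 15 (.sc 10) (.const 0) (.const 1))
        (.setNat 15 (.sc 10) (.const 0) (.const 0))))

/-- Collect value, tie-breaking number and mandatoriness of all units. -/
def attributes : Program := .for 10 (.sc 8) attributesBody

/-- Disjunction of tests. -/
def Test.or (c d : Test) : Test := .not (.and (.not c) (.not d))

/-- Unit number `11` precedes unit number `10` in the order of all units. -/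
def precedes : Test :=
  .or (.natLt (.ent 15 (.sc 11)) (.ent 15 (.sc 10))) <|
  .and (.not (.natLt (.ent 15 (.sc 10)) (.ent 15 (.sc 11)))) <|
  .or (.realLt (.read 2 (.sc 11) (.const 0)) (.read 2 (.sc 10) (.const 0))) <|
  .and (.not (.realLt (.read 2 (.sc 10) (.const 0)) (.read 2 (.sc 11) (.const 0))))
    (.natLt (.ent 14 (.sc 11)) (.ent 14 (.sc 10)))

/-- Account for unit number `11` in the rank of unit number `10`. -/
def ranksBody : Program :=
  .cond precedes (.setNat 17 (.sc 10) (.const 0) (.add (.ent 17 (.sc 10)) (.sc 16))) .skip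

/-- Initialize prices and values: the rank of each unit, multiplied by the scale. -/
def ranks : Program := .for 10 (.sc 8) <| .for 11 (.sc 8) ranksBody

/-- Record unit number `20` if it can be traded for unit number `19` at a lower price than those
found so far. -/
def searchBody : Program :=
  .cond (.and (.natLt (.const 0) (.read 4 (.ent 12 (.sc 20)) (.ent 12 (.sc 19)))) <|
      .and (.not (.realLt (.read 2 (.sc 19) (.const 0)) (.read 2 (.sc 20) (.const 0))))
        (.natLt (.ent 17 (.sc 20)) (.sc 21)))
    (.seq (.setNat 21 (.const 0) (.const 0) (.ent 17 (.sc 20)))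
      (.setNat 22 (.const 0) (.const 0) (.add (.sc 20) (.const 1))))
    .skip

/-- Find a cheapest unit that can be traded for unit number `19` at a price below its value. -/
def search : Program :=
  .seq (.setNat 21 (.const 0) (.const 0) (.ent 17 (.sc 19))) <|
  .seq (.setNat 22 (.const 0) (.const 0) (.const 0)) <|
  .for 20 (.sc 9) searchBody

/-- Match unit number `19` with the unit found, whose partner becomes unmatched and whose price is
increased by one. -/
def bid : Program :=
  .seq (.setNat 22 (.const 0) (.const 0) (.sub (.sc 22) (.const 1))) <|
  .seq (.cond (.natLt (.const 0) (.ent 18 (.sc 22)))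
    (.setNat 18 (.sub (.ent 18 (.sc 22)) (.const 1)) (.const 0) (.const 0)) .skip) <|
  .seq (.setNat 18 (.sc 22) (.const 0) (.add (.sc 19) (.const 1))) <|
  .seq (.setNat 18 (.sc 19) (.const 0) (.add (.sc 22) (.const 1))) <|
  .seq (.setNat 17 (.sc 22) (.const 0) (.add (.ent 17 (.sc 22)) (.const 1)))
    (.setNat 19 (.const 0) (.const 0) (.sc 9))

/-- One step of the auction: the present buyer's unit bids if it is unmatched and can afford some
unit. After a bid, all buyers' units are considered anew. -/
def auctionStep : Program :=
  .cond (.natLt (.const 0) (.ent 18 (.sc 19))) (.inc 19)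
    (.seq search (.cond (.natLt (.const 0) (.sc 22)) bid (.inc 19)))

/-- The auction. -/
def auction : Program :=
  .seq (.setNat 19 (.const 0) (.const 0) (.sc 9)) (.loop (.natLt (.sc 19) (.sc 8)) auctionStep)

/-- Write down the partner of unit number `10`. -/
def writeOutputBody : Program :=
  .cond (.natLt (.const 0) (.ent 18 (.sc 10)))
    (.seq (.setNat 6 (.ent 12 (.sc 10)) (.ent 13 (.sc 10))
        (.add (.ent 12 (.sub (.ent 18 (.sc 10)) (.const 1))) (.const 1)))
      (.setNat 7 (.ent 12 (.sc 10)) (.ent 13 (.sc 10))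
        (.add (.ent 13 (.sub (.ent 18 (.sc 10)) (.const 1))) (.const 1))))
    .skip

/-- Write down the matching in the form required for the output. -/
def writeOutput : Program := .for 10 (.sc 9) writeOutputBody

/-- The part of the algorithm before the auction. -/
def prepare : Program :=
  .seq (flatten 0 2) <|
  .seq (.setNat 9 (.const 0) (.const 0) (.sc 8)) <|
  .seq (flatten 1 3) <|
  .seq (.setNat 16 (.const 0) (.const 0) (.add (.sc 8) (.const 2))) <|
  .seq attributes ranks

/-- The algorithm. -/
def tradingProgram : Program := .seq prepare (.seq auction writeOutput)

/-! ### Numbering the units -/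

/-- The number of units of the agents before agent `s`. -/
def offset (γ : ℕ → ℕ) (s : ℕ) : ℕ := ∑ a ∈ Finset.range s, γ a

theorem offset_succ (γ : ℕ → ℕ) (s : ℕ) : offset γ (s + 1) = offset γ s + γ s :=
  Finset.sum_range_succ _ _

theorem offset_mono (γ : ℕ → ℕ) : Monotone (offset γ) :=
  monotone_nat_of_le_succ fun s => by rw [offset_succ]; omega

theorem offset_add_lt {γ : ℕ → ℕ} {n s i : ℕ} (hs : s < n) (hi : i < γ s) :
    offset γ s + i < offset γ n := by
  have := offset_mono γ (Nat.succ_le_of_lt hs)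
  rw [Nat.succ_eq_add_one, offset_succ] at this
  omega

theorem offset_add_inj {γ : ℕ → ℕ} {a j s i : ℕ} (hj : j < γ a) (hi : i < γ s)
    (h : offset γ a + j = offset γ s + i) : a = s ∧ j = i := by
  have : a = s := by
    rcases lt_trichotomy a s with hlt | heq | hlt
    · have := offset_add_lt hlt hj; omega
    · exact heq
    · have := offset_add_lt hlt hi; omega
  subst this
  exact ⟨rfl, by omega⟩

theorem exists_offset_add {γ : ℕ → ℕ} {n k : ℕ} (h : k < offset γ n) :
    ∃ a < n, ∃ j < γ a, offset γ a + j = k := by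
  induction n with
  | zero => simp [offset] at h
  | succ n ih =>
    by_cases hk : k < offset γ n
    · obtain ⟨a, ha, j, hj, h⟩ := ih hk
      exact ⟨a, by omega, j, hj, h⟩
    · rw [offset_succ] at h
      exact ⟨n, by omega, k - offset γ n, by omega, by omega⟩

/-- In the memory `m'`, the first `K` units starting with unit number `n₀` are numbered; otherwise
the numbering is as in `m`. -/
def Numbered (γ : ℕ → ℕ) (n₀ K : ℕ) (m m' : Memory) : Prop :=
  m'.nat 8 0 0 = n₀ + K ∧
  (∀ a j, j < γ a → offset γ a + j < K →
    m'.nat 12 (n₀ + (offset γ a + j)) 0 = a ∧ m'.nat 13 (n₀ + (offset γ a + j)) 0 = j) ∧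
  ∀ k < n₀, m'.nat 12 k 0 = m.nat 12 k 0 ∧ m'.nat 13 k 0 = m.nat 13 k 0

/-- The program `flatten x y` continues a numbering of `n₀` units with the units of the agents listed
in the array `y`, agent by agent. -/
theorem flatten_spec {x y : ℕ} (hx : x < 8) (hy : y < 8) (m : Memory) {γ : ℕ → ℕ}
    (hγ : ∀ s, m.nat y s 0 = γ s) {n n₀ B : ℕ} (h8 : m.nat 8 0 0 = n₀) (hn : m.nat x 0 0 = n)
    (hnB : n ≤ B) (hB : ∀ s, γ s ≤ B) :
    Spec (flatten x y) m (forTime (.sc x) B (forTime (.ent y (.sc 10)) B flattenBody.time)) fun m' =>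
      Numbered γ n₀ (offset γ n) m m' ∧ Frame (flatten x y) m m' := by
  have hx' : x ≠ 10 ∧ x ≠ 11 ∧ x ≠ 12 ∧ x ≠ 13 ∧ x ≠ 8 := by omega
  have hy' : y ≠ 10 ∧ y ≠ 11 ∧ y ≠ 12 ∧ y ≠ 13 ∧ y ≠ 8 := by omega
  refine Spec.for m n B hnB (fun s m' => Numbered γ n₀ (offset γ s) m m') ?_ ?_ ?_ ?_
  · intro m' hF
    have := hF.1 x (by simp [Program.for, Program.natWrites, flattenBody, hx'])
    simp [NExp.eval, this, hn]
  · simp [Program.for, Program.natWrites, flattenBody]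
  · simp [Numbered, offset, Memory.set, update, h8]
  · intro s hs m₁ hF hI h10
    refine (Spec.for m₁ (γ s) B (hB s) (fun i m' => Numbered γ n₀ (offset γ s + i) m m')
      ?_ ?_ ?_ ?_).mono le_rfl ?_
    · intro m' hF'
      have e1 := hF.1 y (by simp [Program.for, Program.natWrites, flattenBody, hy'])
      have e2 := hF'.1 y (by simp [Program.for, Program.natWrites, flattenBody, hy'])
      have e3 := hF'.1 10 (by simp [Program.for, Program.natWrites, flattenBody])
      simp [NExp.eval, e1, e2, e3, h10, hγ]
    · simp [Program.natWrites, flattenBody]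
    · simpa [Numbered, Memory.set, update] using hI
    · rintro i hi m₂ hF' ⟨g1, g2, g3⟩ h11
      have e3 := hF'.1 10 (by simp [Program.for, Program.natWrites, flattenBody])
      refine Spec.of_loopFree (by simp [flattenBody, Program.LoopFree]) ?_
      refine ⟨?_, ?_, ?_⟩
      · simp [flattenBody, Program.exec, NExp.eval, Memory.set, update, g1, add_assoc]
      · intro a j hj hlt
        simp only [flattenBody, Program.exec, NExp.eval, Memory.set, update, g1, e3, h10, h11]
        by_cases heq : offset γ a + j = offset γ s + i
        · obtain ⟨rfl, rfl⟩ := offset_add_inj hj hi heq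
          simp
        · have := g2 a j hj (by omega)
          simp [heq, this]
      · intro k hk
        have h1 : k ≠ n₀ + (offset γ s + i) := by omega
        have := g3 k hk
        simp [flattenBody, Program.exec, NExp.eval, Memory.set, update, g1, h1, this]
    · rintro m' ⟨hI', -⟩
      rw [← offset_succ] at hI'
      simpa [Numbered, Memory.set, update] using hI'

theorem attributes_spec (m : Memory) {N : ℕ} (hN : m.nat 8 0 0 = N) {B : ℕ} (hB : N ≤ B) :
    Spec attributes m (forTime (.sc 8) B attributesBody.time) fun m' =>
      (∀ k < N,
        (k < m.nat 9 0 0 → m'.real 2 k 0 = m.real 0 (m.nat 12 k 0) (m.nat 13 k 0) ∧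
          m'.nat 14 k 0 = m.nat 13 k 0 ∧ m'.nat 15 k 0 = 0) ∧
        (¬ k < m.nat 9 0 0 → m'.real 2 k 0 = m.real 1 (m.nat 12 k 0) (m.nat 13 k 0) ∧
          m'.nat 14 k 0 = m.nat 3 (m.nat 12 k 0) 0 - m.nat 13 k 0 ∧
          m'.nat 15 k 0 = if m.nat 13 k 0 < m.nat 5 (m.nat 12 k 0) 0 then 1 else 0)) ∧
      Frame attributes m m' := by
  refine Spec.for m N B hB (fun n m' => ∀ k < n,
        (k < m.nat 9 0 0 → m'.real 2 k 0 = m.real 0 (m.nat 12 k 0) (m.nat 13 k 0) ∧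
          m'.nat 14 k 0 = m.nat 13 k 0 ∧ m'.nat 15 k 0 = 0) ∧
        (¬ k < m.nat 9 0 0 → m'.real 2 k 0 = m.real 1 (m.nat 12 k 0) (m.nat 13 k 0) ∧
          m'.nat 14 k 0 = m.nat 3 (m.nat 12 k 0) 0 - m.nat 13 k 0 ∧
          m'.nat 15 k 0 = if m.nat 13 k 0 < m.nat 5 (m.nat 12 k 0) 0 then 1 else 0)) ?_ ?_ ?_ ?_
  · intro m' hF
    have := hF.1 8 (by simp [Program.for, attributesBody, Program.natWrites])
    simp [NExp.eval, this, hN]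
  · simp [attributesBody, Program.natWrites]
  · simp
  · intro n hn m₁ hF hI h10
    have f3 := hF.1 3 (by simp [Program.for, attributesBody, Program.natWrites])
    have f5 := hF.1 5 (by simp [Program.for, attributesBody, Program.natWrites])
    have f9 := hF.1 9 (by simp [Program.for, attributesBody, Program.natWrites])
    have f12 := hF.1 12 (by simp [Program.for, attributesBody, Program.natWrites])
    have f13 := hF.1 13 (by simp [Program.for, attributesBody, Program.natWrites])
    have r0 := hF.2 0 (by simp [Program.for, attributesBody, Program.realWrites])
    have r1 := hF.2 1 (by simp [Program.for, attributesBody, Program.realWrites])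
    refine Spec.of_loopFree (by simp [attributesBody, Program.LoopFree]) ?_
    intro k hk
    by_cases hkn : k = n
    · subst hkn
      by_cases h1 : k < m.nat 9 0 0
      · simp [attributesBody, Program.exec, Test.Holds, NExp.eval, RExp.eval, Memory.set, update,
          f9, f12, f13, r0, h10, h1]
      · by_cases h2 : m.nat 13 k 0 < m.nat 5 (m.nat 12 k 0) 0 <;>
        simp [attributesBody, Program.exec, Test.Holds, NExp.eval, RExp.eval, Memory.set, update,
          f3, f5, f9, f12, f13, r1, h10, h1, h2]
    · have := hI k (by omega)
      by_cases h1 : n < m.nat 9 0 0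
      · simpa [attributesBody, Program.exec, Test.Holds, NExp.eval, RExp.eval, Memory.set, update,
          f9, f12, f13, r0, h10, h1, hkn] using this
      · by_cases h2 : m.nat 13 n 0 < m.nat 5 (m.nat 12 n 0) 0 <;>
        simpa [attributesBody, Program.exec, Test.Holds, NExp.eval, RExp.eval, Memory.set, update,
          f3, f5, f9, f12, f13, r1, h10, h1, h2, hkn] using this

/-! ### Ranking the units -/

/-- The position of unit `k` in the order of all units, as recorded in the memory. -/
noncomputable def Memory.key (m : Memory) (k : ℕ) : ℕ ×ₗ (ℝ ×ₗ ℕ) :=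
  toLex (m.nat 15 k 0, toLex (m.real 2 k 0, m.nat 14 k 0))

open Classical in
/-- The number of units among the first `n` that precede unit `x`. -/
noncomputable def Memory.rank (m : Memory) (x n : ℕ) : ℕ :=
  ((Finset.range n).filter fun y => m.key y < m.key x).card

theorem precedes_holds (m : Memory) :
    precedes.Holds m ↔ m.key (m.nat 11 0 0) < m.key (m.nat 10 0 0) := by
  rw [Memory.key, Memory.key, Prod.Lex.toLex_lt_toLex, Prod.Lex.toLex_lt_toLex]
  simp only [precedes, Test.or, Test.Holds, NExp.eval, RExp.eval]
  have h1 : ∀ a b : ℕ, (a = b) ↔ (¬ a < b ∧ ¬ b < a) := fun a b => by omega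
  have h2 : ∀ a b : ℝ, (a = b) ↔ (¬ a < b ∧ ¬ b < a) := fun a b => by
    rw [not_lt, not_lt, le_antisymm_iff, and_comm]
  rw [h1, h2]
  tauto

theorem ranks_spec (m : Memory) {N D : ℕ} (hN : m.nat 8 0 0 = N) (hD : m.nat 16 0 0 = D)
    (h17 : ∀ x, m.nat 17 x 0 = 0) {B : ℕ} (hB : N ≤ B) :
    Spec ranks m (forTime (.sc 8) B (forTime (.sc 8) B ranksBody.time)) fun m' =>
      (∀ x < N, m'.nat 17 x 0 = D * m.rank x N) ∧ Frame ranks m m' := by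
  refine (Spec.for m N B hB (fun n m' => ∀ x, m'.nat 17 x 0 = if x < n then D * m.rank x N else 0)
    ?_ ?_ ?_ ?_).mono le_rfl ?_
  · intro m' hF
    have := hF.1 8 (by simp [Program.for, ranksBody, Program.natWrites])
    simp [NExp.eval, this, hN]
  · simp [Program.for, ranksBody, Program.natWrites]
  · simp [Memory.set, update, h17]
  · intro n hn m₁ hF hI h10
    refine (Spec.for m₁ N B hB (fun c m' => ∀ x, m'.nat 17 x 0 =
        if x < n then D * m.rank x N else if x = n then D * m.rank x c else 0)
      ?_ ?_ ?_ ?_).mono le_rfl ?_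
    · intro m' hF'
      have e1 := hF.1 8 (by simp [Program.for, ranksBody, Program.natWrites])
      have e2 := hF'.1 8 (by simp [Program.for, ranksBody, Program.natWrites])
      simp [NExp.eval, e1, e2, hN]
    · simp [ranksBody, Program.natWrites]
    · intro x
      have h0 : m.rank x 0 = 0 := by simp [Memory.rank]
      simpa [Memory.set, update, h0] using hI x
    · intro c hc m₂ hF' hI' h11
      have hF'' : Frame ranks m m₂ := hF.trans (hF'.weaken
        (by simp [Program.for, ranksBody, Program.natWrites])
        (by simp [Program.for, ranksBody, Program.realWrites]))
      have e10 := hF'.1 10 (by simp [Program.for, ranksBody, Program.natWrites])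
      have f14 := hF''.1 14 (by simp [ranks, Program.for, ranksBody, Program.natWrites])
      have f15 := hF''.1 15 (by simp [ranks, Program.for, ranksBody, Program.natWrites])
      have f16 := hF''.1 16 (by simp [ranks, Program.for, ranksBody, Program.natWrites])
      have r2 := hF''.2 2 (by simp [ranks, Program.for, ranksBody, Program.realWrites])
      have hkey : ∀ k, m₂.key k = m.key k := fun k => by simp only [Memory.key, f14, f15, r2]
      have hprec : precedes.Holds m₂ ↔ m.key c < m.key n := by
        rw [precedes_holds, hkey, hkey, e10, h10, h11]
      refine Spec.of_loopFree (by simp [ranksBody, Program.LoopFree]) ?_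
      intro x
      have hx := hI' x
      have hrank : m.rank n (c + 1) = m.rank n c + if m.key c < m.key n then 1 else 0 := by
        simp only [Memory.rank, Finset.range_add_one, Finset.filter_insert]
        split_ifs
        · rw [Finset.card_insert_of_notMem (by simp)]
        · rfl
      by_cases hp : m.key c < m.key n
      · by_cases hxn : x = n
        · subst hxn
          simp only [lt_irrefl, if_false, if_true] at hx
          simp [ranksBody, Program.exec, hprec, hp, NExp.eval, Memory.set, update, e10, h10, f16,
            hD, hrank, hx, mul_add]
        · simpa [ranksBody, Program.exec, hprec, hp, NExp.eval, Memory.set, update, e10, h10,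
            hxn] using hx
      · by_cases hxn : x = n
        · subst hxn
          simp only [lt_irrefl, if_false, if_true] at hx
          simp [ranksBody, Program.exec, hprec, hp, Memory.set, update, hrank, hx]
        · simpa [ranksBody, Program.exec, hprec, hp, Memory.set, update, hxn] using hx
    · rintro m' ⟨hI', -⟩ x
      have := hI' x
      simp only [Memory.set, update]
      split_ifs at this ⊢ <;> omega
  · rintro m' ⟨hI, hF⟩
    exact ⟨fun x hx => by rw [hI x, if_pos hx], hF⟩

/-! ### The auction -/

/-- The state of the auction between sellers' units `k < N₁` and buyers' units `N₁ ≤ l < N` in the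
graph `A`, with costs and values `W`, current prices `p` (the values, for buyers' units) and
partners `mate` (shifted by one, `0` meaning unmatched). A matched unit is cheapest for its buyer up
to an error of `1`. -/
structure AuctionState (N₁ N : ℕ) (A : ℕ → ℕ → Prop) (W p mate : ℕ → ℕ) : Prop where
  seller : ∀ k < N₁, mate k ≠ 0 → ∃ l, N₁ ≤ l ∧ l < N ∧ mate k = l + 1 ∧ mate l = k + 1 ∧ A k l ∧
    p k ≤ W l ∧ ∀ k' < N₁, A k' l → p k ≤ p k' + 1
  buyer : ∀ l, N₁ ≤ l → l < N → mate l ≠ 0 → ∃ k < N₁, mate l = k + 1 ∧ mate k = l + 1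
  free : ∀ k < N₁, mate k = 0 → p k = W k
  cost_le : ∀ k < N₁, W k ≤ p k
  value : ∀ l, N₁ ≤ l → l < N → p l = W l

/-- The state is preserved when the unmatched buyer's unit `l` takes its cheapest affordable
neighbour `k`, whose former partner, if any, becomes unmatched. -/
theorem AuctionState.bid {N₁ N : ℕ} {A : ℕ → ℕ → Prop} {W p mate p' mate' : ℕ → ℕ}
    (h : AuctionState N₁ N A W p mate) {k l : ℕ} (hk : k < N₁) (hl : N₁ ≤ l) (hlN : l < N)
    (hkl : A k l) (hml : mate l = 0) (hp : p k < p l) (hmin : ∀ k' < N₁, A k' l → p k ≤ p k')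
    (hp' : ∀ x, p' x = if x = k then p k + 1 else p x)
    (hm' : ∀ x, mate' x =
      if x = l then k + 1 else if x = k then l + 1 else
        if mate k ≠ 0 ∧ x = mate k - 1 then 0 else mate x) :
    AuctionState N₁ N A W p' mate' := by
  have hpl := h.value l hl hlN
  have hle : ∀ x, p x ≤ p' x := fun x => by
    rw [hp']; split_ifs with hx <;> [subst hx; skip] <;> omega
  refine ⟨?_, ?_, ?_, ?_, ?_⟩
  · intro k₁ hk₁ hne
    by_cases hkk : k₁ = k
    · subst hkk
      refine ⟨l, hl, hlN, ?_, ?_, hkl, ?_, ?_⟩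
      · rw [hm', if_neg (by omega), if_pos rfl]
      · rw [hm', if_pos rfl]
      · rw [hp', if_pos rfl]; omega
      · intro k' hk' hA
        have := hmin k' hk' hA
        have := hle k'
        rw [hp', if_pos rfl]; omega
    -- other matched units of sellers keep their partners, since `l` was unmatched and only the
    -- former partner of `k` is displaced
    · have e1 : mate' k₁ = mate k₁ := by
        rw [hm', if_neg (by omega), if_neg hkk, if_neg]
        rintro ⟨h1, h2⟩
        obtain ⟨l', h3, -, h4, -⟩ := h.seller k hk h1
        omega
      obtain ⟨l₁, g1, g2, g3, g4, g5, g6, g7⟩ := h.seller k₁ hk₁ (by rwa [← e1])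
      refine ⟨l₁, g1, g2, by rw [e1, g3], ?_, g5, ?_, ?_⟩
      · rw [hm', if_neg, if_neg (by omega), if_neg, g4]
        · rintro ⟨h1, h2⟩
          obtain ⟨l', h3, h3', h4, h5, -⟩ := h.seller k hk h1
          have : l₁ = l' := by omega
          subst this
          omega
        · rintro rfl; omega
      · rwa [hp', if_neg hkk]
      · intro k' hk' hA
        have := g7 k' hk' hA
        have := hle k'
        rw [hp', if_neg hkk]; omega
  · intro l₁ hl₁ hlN₁ hne
    by_cases hll : l₁ = l
    · subst hll
      exact ⟨k, hk, by rw [hm', if_pos rfl], by rw [hm', if_neg (by omega), if_pos rfl]⟩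
    · have hnn : ¬ (mate k ≠ 0 ∧ l₁ = mate k - 1) := by
        intro hc
        rw [hm', if_neg hll, if_neg (by omega), if_pos hc] at hne
        exact hne rfl
      have e1 : mate' l₁ = mate l₁ := by
        rw [hm', if_neg hll, if_neg (by omega), if_neg hnn]
      obtain ⟨k₁, hk₁, g1, g2⟩ := h.buyer l₁ hl₁ hlN₁ (by rwa [← e1])
      refine ⟨k₁, hk₁, by rw [e1, g1], ?_⟩
      have hkk : k₁ ≠ k := by
        rintro rfl
        exact hnn ⟨by omega, by omega⟩
      rw [hm', if_neg (by omega), if_neg hkk, if_neg, g2]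
      rintro ⟨h1, h2⟩
      obtain ⟨l', h3, -, h4, -⟩ := h.seller k hk h1
      omega
  · intro k₁ hk₁ h0
    have hkk : k₁ ≠ k := by
      rintro rfl
      rw [hm', if_neg (by omega), if_pos rfl] at h0
      omega
    rw [hp', if_neg hkk]
    refine h.free k₁ hk₁ ?_
    rwa [hm', if_neg (by omega), if_neg hkk, if_neg] at h0
    rintro ⟨h1, h2⟩
    obtain ⟨l', h3, -, h4, -⟩ := h.seller k hk h1
    omega
  · intro k₁ hk₁
    exact (h.cost_le k₁ hk₁).trans (hle k₁)
  · intro l₁ hl₁ hlN₁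
    rw [hp', if_neg (by omega), h.value l₁ hl₁ hlN₁]

/-- The units `k` and `l` can be traded, according to the data recorded in the memory. -/
def Memory.Adj (m : Memory) (k l : ℕ) : Prop :=
  0 < m.nat 4 (m.nat 12 k 0) (m.nat 12 l 0) ∧ m.real 2 k 0 ≤ m.real 2 l 0

theorem search_spec (m : Memory) {N₁ l : ℕ} (h9 : m.nat 9 0 0 = N₁) (h19 : m.nat 19 0 0 = l)
    {B : ℕ} (hB : N₁ ≤ B) :
    Spec search m (8 + (4 + forTime (.sc 9) B searchBody.time)) fun m' =>
      ((m'.nat 22 0 0 = 0 ∧ ∀ k < N₁, m.Adj k l → m.nat 17 l 0 ≤ m.nat 17 k 0) ∨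
       ∃ k < N₁, m'.nat 22 0 0 = k + 1 ∧ m.Adj k l ∧ m.nat 17 k 0 < m.nat 17 l 0 ∧
        ∀ k' < N₁, m.Adj k' l → m.nat 17 k 0 ≤ m.nat 17 k' 0) ∧
      Frame search m m' := by
  refine (Spec.seq (Q := fun m' => m'.nat 21 0 0 = m.nat 17 l 0 ∧ Frame search m m') ?_ fun m₁ h₁ =>
    Spec.seq (Q := fun m' => m'.nat 21 0 0 = m.nat 17 l 0 ∧ m'.nat 22 0 0 = 0 ∧ Frame search m m')
      ?_ fun m₂ h₂ =>
    (Spec.for m₂ N₁ B hB (fun n m' =>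
      (m'.nat 22 0 0 = 0 ∧ m'.nat 21 0 0 = m.nat 17 l 0 ∧
        ∀ k < n, m.Adj k l → m.nat 17 l 0 ≤ m.nat 17 k 0) ∨
      ∃ k < n, m'.nat 22 0 0 = k + 1 ∧ m'.nat 21 0 0 = m.nat 17 k 0 ∧ m.Adj k l ∧
        m.nat 17 k 0 < m.nat 17 l 0 ∧ ∀ k' < n, m.Adj k' l → m.nat 17 k 0 ≤ m.nat 17 k' 0)
      ?_ ?_ ?_ ?_).mono le_rfl fun _ h => h.1).frame.mono le_rfl ?_
  · refine (Spec.of_loopFree (P := .setNat 21 _ _ _) (Q := fun m' => m'.nat 21 0 0 = m.nat 17 l 0)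
      trivial ?_).frame.mono (by decide) fun m' h => ⟨h.1, h.2.weaken ?_ ?_⟩
    · simp [Program.exec, NExp.eval, update, h19]
    · simp [search, Program.natWrites]
    · simp [Program.realWrites]
  · refine (Spec.of_loopFree (P := .setNat 22 _ _ _)
      (Q := fun m' => m'.nat 21 0 0 = m.nat 17 l 0 ∧ m'.nat 22 0 0 = 0)
      trivial ?_).frame.mono (by decide) fun m' h => ⟨h.1.1, h.1.2, h₁.2.trans (h.2.weaken ?_ ?_)⟩
    · simp [Program.exec, NExp.eval, update, h₁.1]
    · simp [search, Program.natWrites]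
    · simp [Program.realWrites]
  · intro m' hF
    have e1 := h₂.2.2.1 9 (by simp [search, Program.for, searchBody, Program.natWrites])
    have e2 := hF.1 9 (by simp [Program.for, searchBody, Program.natWrites])
    simp [NExp.eval, e1, e2, h9]
  · simp [searchBody, Program.natWrites]
  · exact Or.inl (by simp [Memory.set, update, h₂.1, h₂.2.1])
  · intro n hn m₃ hF hI h20
    have hF' : Frame search m m₃ := h₂.2.2.trans (hF.weaken
      (by simp [search, Program.for, searchBody, Program.natWrites])
      (by simp [search, Program.for, searchBody, Program.realWrites]))
    have f4 := hF'.1 4 (by simp [search, Program.for, searchBody, Program.natWrites])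
    have f12 := hF'.1 12 (by simp [search, Program.for, searchBody, Program.natWrites])
    have f17 := hF'.1 17 (by simp [search, Program.for, searchBody, Program.natWrites])
    have f19 := hF'.1 19 (by simp [search, Program.for, searchBody, Program.natWrites])
    have r2 := hF'.2 2 (by simp [search, Program.for, searchBody, Program.realWrites])
    refine Spec.of_loopFree (by simp [searchBody, Program.LoopFree]) ?_
    have hc : (Test.and (.natLt (.const 0) (.read 4 (.ent 12 (.sc 20)) (.ent 12 (.sc 19)))) <|
        .and (.not (.realLt (.read 2 (.sc 19) (.const 0)) (.read 2 (.sc 20) (.const 0))))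
          (.natLt (.ent 17 (.sc 20)) (.sc 21))).Holds m₃ ↔
        m.Adj n l ∧ m.nat 17 n 0 < m₃.nat 21 0 0 := by
      simp [Test.Holds, NExp.eval, RExp.eval, f4, f12, f17, f19, r2, h19, h20, Memory.Adj,
        and_assoc]
    by_cases hcn : m.Adj n l ∧ m.nat 17 n 0 < m₃.nat 21 0 0
    · rw [searchBody, Program.exec, if_pos (hc.2 hcn)]
      obtain ⟨hA, hlt⟩ := hcn
      have hlt' : m.nat 17 n 0 < m.nat 17 l 0 := by
        rcases hI with ⟨-, g, -⟩ | ⟨k, hk, -, g, -, g', -⟩ <;> omega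
      refine Or.inr ⟨n, by omega, ?_, ?_, hA, hlt', ?_⟩
      · simp [Program.exec, NExp.eval, Memory.set, update, h20]
      · simp [Program.exec, NExp.eval, Memory.set, update, h20, f17]
      · intro k' hk' hA'
        by_cases hkn : k' = n
        · rw [hkn]
        · rcases hI with ⟨-, g, g'⟩ | ⟨k, hk, -, g, -, -, g'⟩ <;>
            have := g' k' (by omega) hA' <;> omega
    · rw [searchBody, Program.exec, if_neg (mt hc.1 hcn), Program.exec]
      rcases hI with ⟨g1, g2, g3⟩ | ⟨k, hk, g1, g2, g3, g4, g5⟩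
      · refine Or.inl ⟨by simpa [Memory.set, update] using g1,
          by simpa [Memory.set, update] using g2, fun k hk hA => ?_⟩
        by_cases hkn : k = n
        · subst hkn
          by_contra hlt
          exact hcn ⟨hA, by omega⟩
        · exact g3 k (by omega) hA
      · refine Or.inr ⟨k, by omega, by simpa [Memory.set, update] using g1,
          by simpa [Memory.set, update] using g2, g3, g4, fun k' hk' hA => ?_⟩
        by_cases hkn : k' = n
        · subst hkn
          by_contra hlt
          exact hcn ⟨hA, by omega⟩
        · exact g5 k' (by omega) hA
  · rintro m' ⟨hI, hF⟩
    refine ⟨?_, hF⟩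
    rcases hI with ⟨g1, -, g3⟩ | ⟨k, hk, g1, -, g3, g4, g5⟩
    · exact Or.inl ⟨g1, g3⟩
    · exact Or.inr ⟨k, hk, g1, g3, g4, g5⟩

/-- A bound for the running time of one step of the auction. -/
def stepTime (B : ℕ) : ℕ :=
  12 + (8 + (8 + (4 + forTime (.sc 9) B searchBody.time) + (5 + (bid.time + 8))))

/-- The effect of `bid`. If the unit `k` has no partner, the entry of nobody is cleared, although
the truncated difference `m.nat 18 k 0 - 1` is then the number of a unit. -/
theorem bid_exec (m : Memory) {k l : ℕ} (h22 : m.nat 22 0 0 = k + 1) (h19 : m.nat 19 0 0 = l) :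
    (bid.exec m).nat 19 0 0 = m.nat 9 0 0 ∧
    (∀ x, (bid.exec m).nat 17 x 0 = if x = k then m.nat 17 k 0 + 1 else m.nat 17 x 0) ∧
    ∀ x, (bid.exec m).nat 18 x 0 =
      if x = l then k + 1 else if x = k then l + 1 else
        if m.nat 18 k 0 ≠ 0 ∧ x = m.nat 18 k 0 - 1 then 0 else m.nat 18 x 0 := by
  by_cases h : 0 < m.nat 18 k 0
  · have h' : m.nat 18 k 0 ≠ 0 := by omega
    refine ⟨?_, fun x => ?_, fun x => ?_⟩
    · simp [bid, Program.exec, NExp.eval, Test.Holds, update, h22, h19, h]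
    · simp [bid, Program.exec, NExp.eval, Test.Holds, update, h22, h19, h]
    · simp [bid, Program.exec, NExp.eval, Test.Holds, update, h22, h19, h, h']
  · have h' : m.nat 18 k 0 = 0 := by omega
    refine ⟨?_, fun x => ?_, fun x => ?_⟩
    · simp [bid, Program.exec, NExp.eval, Test.Holds, update, h22, h19, h']
    · simp [bid, Program.exec, NExp.eval, Test.Holds, update, h22, h19, h']
    · simp [bid, Program.exec, NExp.eval, Test.Holds, update, h22, h19, h']

/-- Each step of the auction decreases the sum of the distances of the prices from the bound `M` or,
leaving the prices unchanged, the number of buyers' units still to be considered. All buyers' units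
before the present one are matched or find all their neighbours too expensive. -/
theorem auctionStep_spec (m : Memory) {N₁ N l M B : ℕ} {W : ℕ → ℕ} (hB : N₁ ≤ B)
    (h9 : m.nat 9 0 0 = N₁) (h19 : m.nat 19 0 0 = l) (hl : N₁ ≤ l) (hlN : l < N)
    (hW : ∀ x < N, W x ≤ M)
    (hs : AuctionState N₁ N m.Adj W (m.nat 17 · 0) (m.nat 18 · 0))
    (hdone : ∀ l', N₁ ≤ l' → l' < l → m.nat 18 l' 0 = 0 → ∀ k < N₁, m.Adj k l' →
      m.nat 17 l' 0 ≤ m.nat 17 k 0) :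
    Spec auctionStep m (stepTime B) fun m' =>
      ((N₁ ≤ m'.nat 19 0 0 ∧ m'.nat 19 0 0 ≤ N ∧
        AuctionState N₁ N m.Adj W (m'.nat 17 · 0) (m'.nat 18 · 0) ∧
        ∀ l', N₁ ≤ l' → l' < m'.nat 19 0 0 → m'.nat 18 l' 0 = 0 → ∀ k < N₁, m.Adj k l' →
          m'.nat 17 l' 0 ≤ m'.nat 17 k 0) ∧
       (∑ k ∈ Finset.range N₁, (M - m'.nat 17 k 0)) * (N + 1) + (N - m'.nat 19 0 0) <
        (∑ k ∈ Finset.range N₁, (M - m.nat 17 k 0)) * (N + 1) + (N - l)) ∧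
      Frame auctionStep m m' := by
  refine Spec.frame ?_
  have hinc : ∀ m' : Memory, m'.nat 17 = m.nat 17 → m'.nat 18 = m.nat 18 → m'.nat 19 0 0 = l →
      (m.nat 18 l 0 = 0 → ∀ k < N₁, m.Adj k l → m.nat 17 l 0 ≤ m.nat 17 k 0) →
      Spec (.inc 19) m' 8 fun m' =>
      (N₁ ≤ m'.nat 19 0 0 ∧ m'.nat 19 0 0 ≤ N ∧
        AuctionState N₁ N m.Adj W (m'.nat 17 · 0) (m'.nat 18 · 0) ∧
        ∀ l', N₁ ≤ l' → l' < m'.nat 19 0 0 → m'.nat 18 l' 0 = 0 → ∀ k < N₁, m.Adj k l' →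
          m'.nat 17 l' 0 ≤ m'.nat 17 k 0) ∧
       (∑ k ∈ Finset.range N₁, (M - m'.nat 17 k 0)) * (N + 1) + (N - m'.nat 19 0 0) <
        (∑ k ∈ Finset.range N₁, (M - m.nat 17 k 0)) * (N + 1) + (N - l) := by
    intro m' e17 e18 e19 hl0
    refine Spec.of_loopFree (P := .inc 19) trivial ?_
    have g17 : ((Program.inc 19).exec m').nat 17 = m.nat 17 := by
      funext i k; simp [Program.exec, update, e17]
    have g18 : ((Program.inc 19).exec m').nat 18 = m.nat 18 := by
      funext i k; simp [Program.exec, update, e18]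
    have g19 : ((Program.inc 19).exec m').nat 19 0 0 = l + 1 := by
      simp [Program.exec, NExp.eval, update, e19]
    rw [g17, g18, g19]
    refine ⟨⟨by omega, by omega, hs, fun l' h1 h2 h3 => ?_⟩, by omega⟩
    by_cases h : l' = l
    · subst h; exact hl0 h3
    · exact hdone l' h1 (by omega) h3
  by_cases hm : 0 < m.nat 18 l 0
  · obtain ⟨m', t, hr, ht, hq⟩ := hinc m rfl rfl h19 fun h => by omega
    refine ⟨m', _, .condTrue (by simpa [Test.Holds, NExp.eval, h19] using hm) hr, ?_, hq⟩
    simp only [Test.cost, NExp.cost, stepTime]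
    omega
  · have hm0 : m.nat 18 l 0 = 0 := by omega
    obtain ⟨m₁, t₁, hr₁, ht₁, hq₁, hF₁⟩ := search_spec m h9 h19 hB
    have e9 := hF₁.1 9 (by simp [search, Program.for, searchBody, Program.natWrites])
    have e17 := hF₁.1 17 (by simp [search, Program.for, searchBody, Program.natWrites])
    have e18 := hF₁.1 18 (by simp [search, Program.for, searchBody, Program.natWrites])
    have e19 := hF₁.1 19 (by simp [search, Program.for, searchBody, Program.natWrites])
    have hm' : ¬ (Test.natLt (.const 0) (.ent 18 (.sc 19))).Holds m := by
      simpa [Test.Holds, NExp.eval, h19] using hm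
    rcases hq₁ with ⟨h22, hno⟩ | ⟨k, hk, h22, hA, hlt, hmin⟩
    · obtain ⟨m', t, hr, ht, hq⟩ := hinc m₁ e17 e18 (by rw [e19, h19]) fun _ => hno
      refine ⟨m', _, .condFalse hm' (.seq hr₁ (.condFalse ?_ hr)), ?_, hq⟩
      · simp [Test.Holds, NExp.eval, h22]
      · simp only [Test.cost, NExp.cost, stepTime]
        omega
    · obtain ⟨t, ht, hr⟩ := Program.LoopFree.runs (P := bid) (by simp [bid, Program.LoopFree]) m₁
      obtain ⟨b19, b17, b18⟩ := bid_exec m₁ h22 (by rw [e19, h19])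
      rw [e9, h9] at b19
      rw [e17] at b17
      rw [e18] at b18
      refine ⟨_, _, .condFalse hm' (.seq hr₁ (.condTrue ?_ hr)), ?_, ⟨?_, ?_, ?_, ?_⟩, ?_⟩
      · simp [Test.Holds, NExp.eval, h22]
      · simp only [Test.cost, NExp.cost, stepTime]
        omega
      · rw [b19]
      · rw [b19]; omega
      · exact hs.bid hk hl hlN hA hm0 hlt hmin b17 b18
      · rw [b19]
        intro l' h1 h2
        omega
      · have hM : m.nat 17 k 0 < M := hlt.trans_le ((hs.value l hl hlN).le.trans (hW l hlN))
        have hsum : ∑ k ∈ Finset.range N₁, (M - (bid.exec m₁).nat 17 k 0) + 1 ≤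
            ∑ k ∈ Finset.range N₁, (M - m.nat 17 k 0) := by
          refine Nat.succ_le_of_lt
            (Finset.sum_lt_sum (fun x _ => ?_) ⟨k, Finset.mem_range.2 hk, ?_⟩)
          · rw [b17]; split_ifs with hx <;> [subst hx; skip] <;> omega
          · rw [b17, if_pos rfl]; omega
        have := Nat.mul_le_mul_right (N + 1) hsum
        rw [add_mul] at this
        rw [b19]
        omega

/-- A bound for the running time of the auction, where `M` is a bound for the values. -/
def auctionTime (B M : ℕ) : ℕ :=
  6 + ((B * M * (B + 1) + B) * (8 + stepTime B) + 8)

/-- In the end, no unmatched buyer's unit has a neighbour with a price below its value. -/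
theorem auction_spec (m : Memory) {N₁ N M B : ℕ} (hN₁ : N₁ ≤ N) (hB : N ≤ B)
    (h8 : m.nat 8 0 0 = N) (h9 : m.nat 9 0 0 = N₁) (hW : ∀ x < N, m.nat 17 x 0 ≤ M)
    (h18 : ∀ x, m.nat 18 x 0 = 0) :
    Spec auction m (auctionTime B M) fun m' =>
      (AuctionState N₁ N m.Adj (m.nat 17 · 0) (m'.nat 17 · 0) (m'.nat 18 · 0) ∧
        ∀ l, N₁ ≤ l → l < N → m'.nat 18 l 0 = 0 → ∀ k < N₁, m.Adj k l →
          m.nat 17 l 0 ≤ m'.nat 17 k 0) ∧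
      Frame auction m m' := by
  refine Spec.frame ?_
  have first : Spec (.setNat 19 (.const 0) (.const 0) (.sc 9)) m 6 fun m' => m' = m.set 19 N₁ :=
    Spec.of_loopFree (P := .setNat 19 (.const 0) (.const 0) (.sc 9)) trivial (by
      simp [Program.exec, NExp.eval, Memory.set, h9])
  refine Spec.seq first ?_
  rintro _ rfl
  have hfr : Frame auctionStep m (m.set 19 N₁) := by
    refine ⟨fun y hy => ?_, fun _ _ => rfl⟩
    have : y ≠ 19 := by
      rintro rfl
      simp [auctionStep, Program.natWrites] at hy
    funext i k
    simp [Memory.set, update, this]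
  have key := Spec.loop (c := .natLt (.sc 19) (.sc 8)) (P := auctionStep) (T := stepTime B)
    (fun m' => Frame auctionStep m m' ∧ N₁ ≤ m'.nat 19 0 0 ∧ m'.nat 19 0 0 ≤ N ∧
      AuctionState N₁ N m.Adj (m.nat 17 · 0) (m'.nat 17 · 0) (m'.nat 18 · 0) ∧
      ∀ l', N₁ ≤ l' → l' < m'.nat 19 0 0 → m'.nat 18 l' 0 = 0 → ∀ k < N₁, m.Adj k l' →
        m'.nat 17 l' 0 ≤ m'.nat 17 k 0)
    (fun m' => (∑ k ∈ Finset.range N₁, (M - m'.nat 17 k 0)) * (N + 1) + (N - m'.nat 19 0 0))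
    (by
      rintro m₁ ⟨hF, hl, -, hs, hd⟩ hc
      have hw : ∀ y ∈ [4, 8, 9, 12], m₁.nat y = m.nat y := fun y hy => hF.1 y (by
        revert y; decide)
      have r2 := hF.2 2 (by decide)
      have hA : m₁.Adj = m.Adj := by
        funext k l
        simp only [Memory.Adj, hw 4 (by simp), hw 12 (by simp), r2]
      have hlN : m₁.nat 19 0 0 < N := by
        simpa [Test.Holds, NExp.eval, hw 8 (by simp), h8] using hc
      rw [← hA] at hs hd
      refine (auctionStep_spec m₁ (hN₁.trans hB) (by rw [hw 9 (by simp), h9]) rfl hl hlN hW hs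
        hd).mono le_rfl ?_
      rintro m' ⟨⟨⟨g1, g2, g3, g4⟩, g5⟩, hF'⟩
      rw [hA] at g3 g4
      exact ⟨⟨hF.trans hF', g1, g2, g3, g4⟩, g5⟩)
    (m.set 19 N₁) (by
      refine ⟨hfr, ?_, ?_, ?_, ?_⟩
      · simp [Memory.set, update]
      · simpa [Memory.set, update] using hN₁
      · refine ⟨?_, ?_, ?_, ?_, ?_⟩ <;> simp [Memory.set, update, h18]
      · intro l' h1 h2
        simp only [Memory.set, update] at h2
        simp at h2
        omega)
  refine key.mono ?_ ?_
  · have h1 : ∑ k ∈ Finset.range N₁, (M - (m.set 19 N₁).nat 17 k 0) ≤ B * M := by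
      refine (Finset.sum_le_card_nsmul _ _ M fun _ _ => Nat.sub_le _ _).trans ?_
      rw [Finset.card_range, smul_eq_mul]
      exact Nat.mul_le_mul_right _ (hN₁.trans hB)
    simp only [Test.cost, NExp.cost]
    have h2 := Nat.mul_le_mul h1 (Nat.succ_le_succ hB)
    have h3 : N - (m.set 19 N₁).nat 19 0 0 ≤ B := (Nat.sub_le _ _).trans hB
    have h4 := Nat.mul_le_mul_right (8 + stepTime B) (add_le_add h2 h3)
    exact Nat.add_le_add_right h4 8
  · rintro m' ⟨⟨hF, g1, g2, g3, g4⟩, hc⟩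
    have h8' := hF.1 8 (by decide)
    have hge : N ≤ m'.nat 19 0 0 := by
      simpa [Test.Holds, NExp.eval, h8', h8] using hc
    refine ⟨g3, fun l hl hlN h0 k hk hA => ?_⟩
    have := g4 l hl (by omega) h0 k hk hA
    rwa [g3.value l hl hlN] at this

/-! ### Writing the output -/

theorem writeOutput_spec (m : Memory) {N₁ B : ℕ} (hB : N₁ ≤ B) (h9 : m.nat 9 0 0 = N₁)
    (hinj : ∀ k < N₁, ∀ k' < N₁, m.nat 12 k 0 = m.nat 12 k' 0 → m.nat 13 k 0 = m.nat 13 k' 0 →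
      k = k')
    (h6 : ∀ i j, m.nat 6 i j = 0) (h7 : ∀ i j, m.nat 7 i j = 0) :
    Spec writeOutput m (forTime (.sc 9) B writeOutputBody.time) fun m' =>
      (∀ k < N₁,
        (m'.nat 6 (m.nat 12 k 0) (m.nat 13 k 0) =
          if 0 < m.nat 18 k 0 then m.nat 12 (m.nat 18 k 0 - 1) 0 + 1 else 0) ∧
        m'.nat 7 (m.nat 12 k 0) (m.nat 13 k 0) =
          if 0 < m.nat 18 k 0 then m.nat 13 (m.nat 18 k 0 - 1) 0 + 1 else 0) ∧
      Frame writeOutput m m' := by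
  refine (Spec.for m N₁ B hB (fun n m' => ∀ k < N₁,
      (m'.nat 6 (m.nat 12 k 0) (m.nat 13 k 0) =
        if k < n ∧ 0 < m.nat 18 k 0 then m.nat 12 (m.nat 18 k 0 - 1) 0 + 1 else 0) ∧
      m'.nat 7 (m.nat 12 k 0) (m.nat 13 k 0) =
        if k < n ∧ 0 < m.nat 18 k 0 then m.nat 13 (m.nat 18 k 0 - 1) 0 + 1 else 0)
    ?_ ?_ ?_ ?_).mono le_rfl ?_
  · intro m' hF
    have := hF.1 9 (by decide)
    simp [NExp.eval, this, h9]
  · decide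
  · simp [Memory.set, update, h6, h7]
  · intro n hn m₁ hF hI h10
    have f12 := hF.1 12 (by decide)
    have f13 := hF.1 13 (by decide)
    have f18 := hF.1 18 (by decide)
    refine Spec.of_loopFree (by simp [writeOutputBody, Program.LoopFree]) ?_
    intro k hk
    have hIk := hI k hk
    by_cases hkn : k = n
    · subst hkn
      by_cases h0 : 0 < m.nat 18 k 0
      · simp [writeOutputBody, Program.exec, NExp.eval, Test.Holds, Memory.set, update, h10, f12,
          f13, f18, h0]
      · have h0' : m.nat 18 k 0 = 0 := by omega
        simpa [writeOutputBody, Program.exec, NExp.eval, Test.Holds, Memory.set, update, h10,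
          f18, h0'] using hIk
    · have hne : ¬ (m.nat 12 k 0 = m.nat 12 n 0 ∧ m.nat 13 k 0 = m.nat 13 n 0) := fun h =>
        hkn (hinj k hk n hn h.1 h.2)
      have hlt : k < n + 1 ↔ k < n := by omega
      by_cases h0 : 0 < m.nat 18 n 0
      · simpa [writeOutputBody, Program.exec, NExp.eval, Test.Holds, Memory.set, update, h10, f12,
          f13, f18, h0, hne, hlt] using hIk
      · have h0' : m.nat 18 n 0 = 0 := by omega
        simpa [writeOutputBody, Program.exec, NExp.eval, Test.Holds, Memory.set, update, h10,
          f18, h0', hlt] using hIk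
  · rintro m' ⟨hI, hF⟩
    refine ⟨fun k hk => ?_, hF⟩
    simpa [hk] using hI k hk

namespace Instance

variable (I : Instance)

/-! ### Numbered units of an instance -/

/-- The numbers of units of the sellers, as written in the input. -/
noncomputable def sellerUnits (s : ℕ) : ℕ := I.input.nat 2 s 0

/-- The numbers of units of the buyers, as written in the input. -/
noncomputable def buyerUnits (b : ℕ) : ℕ := I.input.nat 3 b 0

/-- The total number of units of all sellers. -/
noncomputable def sellerTotal : ℕ := offset I.sellerUnits I.nS

/-- The total number of units. -/
noncomputable def unitTotal : ℕ := I.sellerTotal + offset I.buyerUnits I.nB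

/-- The number given to a unit by the program. -/
noncomputable def number : I.SUnit ⊕ I.BUnit → ℕ
  | .inl u => offset I.sellerUnits u.1 + u.2
  | .inr v => I.sellerTotal + (offset I.buyerUnits v.1 + v.2)

variable {I}

theorem sellerUnits_val (s : Fin I.nS) : I.sellerUnits s = I.γS s := by
  simp [sellerUnits, input]

theorem buyerUnits_val (b : Fin I.nB) : I.buyerUnits b = I.γB b := by
  simp [buyerUnits, input]

theorem sellerTotal_eq : I.sellerTotal = ∑ s, I.γS s := by
  rw [sellerTotal, offset, ← Fin.sum_univ_eq_sum_range]
  exact Finset.sum_congr rfl fun s _ => sellerUnits_val s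

theorem unitTotal_eq : I.unitTotal = ∑ s, I.γS s + ∑ b, I.γB b := by
  rw [unitTotal, sellerTotal_eq, offset, ← Fin.sum_univ_eq_sum_range]
  exact congrArg _ (Finset.sum_congr rfl fun b _ => buyerUnits_val b)

theorem unitTotal_le_size : I.unitTotal ≤ I.size := by
  rw [unitTotal_eq, size]; omega

theorem sellerUnits_le_size (s : ℕ) : I.sellerUnits s ≤ I.size := by
  by_cases h : s < I.nS
  · rw [show I.sellerUnits s = I.γS ⟨s, h⟩ from sellerUnits_val ⟨s, h⟩]
    have := Finset.single_le_sum (f := I.γS) (fun _ _ => Nat.zero_le _) (Finset.mem_univ ⟨s, h⟩)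
    rw [size]; omega
  · simp [sellerUnits, input, h]

theorem buyerUnits_le_size (b : ℕ) : I.buyerUnits b ≤ I.size := by
  by_cases h : b < I.nB
  · rw [show I.buyerUnits b = I.γB ⟨b, h⟩ from buyerUnits_val ⟨b, h⟩]
    have := Finset.single_le_sum (f := I.γB) (fun _ _ => Nat.zero_le _) (Finset.mem_univ ⟨b, h⟩)
    rw [size]; omega
  · simp [buyerUnits, input, h]

theorem number_inl_lt (u : I.SUnit) : I.number (.inl u) < I.sellerTotal :=
  offset_add_lt u.1.isLt (by rw [sellerUnits_val]; exact u.2.isLt)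

theorem number_inr_lt (v : I.BUnit) : I.number (.inr v) < I.unitTotal :=
  Nat.add_lt_add_left (offset_add_lt v.1.isLt (by rw [buyerUnits_val]; exact v.2.isLt)) _

theorem le_number_inr (v : I.BUnit) : I.sellerTotal ≤ I.number (.inr v) := Nat.le_add_right _ _

theorem number_lt (x : I.SUnit ⊕ I.BUnit) : I.number x < I.unitTotal := by
  rcases x with u | v
  · exact (number_inl_lt u).trans_le (Nat.le_add_right _ _)
  · exact number_inr_lt v

theorem exists_number_inl {k : ℕ} (h : k < I.sellerTotal) :
    ∃ u : I.SUnit, I.number (.inl u) = k := by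
  obtain ⟨s, hs, i, hi, rfl⟩ := exists_offset_add h
  rw [show I.sellerUnits s = I.γS ⟨s, hs⟩ from sellerUnits_val ⟨s, hs⟩] at hi
  exact ⟨⟨⟨s, hs⟩, ⟨i, hi⟩⟩, rfl⟩

theorem exists_number_inr {l : ℕ} (h : I.sellerTotal ≤ l) (h' : l < I.unitTotal) :
    ∃ v : I.BUnit, I.number (.inr v) = l := by
  obtain ⟨d, rfl⟩ := Nat.exists_eq_add_of_le h
  obtain ⟨b, hb, j, hj, rfl⟩ := exists_offset_add (Nat.lt_of_add_lt_add_left h')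
  rw [show I.buyerUnits b = I.γB ⟨b, hb⟩ from buyerUnits_val ⟨b, hb⟩] at hj
  exact ⟨⟨⟨b, hb⟩, ⟨j, hj⟩⟩, rfl⟩

theorem SUnit.ext_val {u u' : I.SUnit} (h₁ : (u.1 : ℕ) = u'.1) (h₂ : (u.2 : ℕ) = u'.2) :
    u = u' := by
  obtain ⟨s, i⟩ := u
  obtain ⟨s', i'⟩ := u'
  obtain rfl : s = s' := Fin.ext h₁
  obtain rfl : i = i' := Fin.ext h₂
  rfl

theorem BUnit.ext_val {v v' : I.BUnit} (h₁ : (v.1 : ℕ) = v'.1) (h₂ : (v.2 : ℕ) = v'.2) :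
    v = v' := by
  obtain ⟨b, j⟩ := v
  obtain ⟨b', j'⟩ := v'
  obtain rfl : b = b' := Fin.ext h₁
  obtain rfl : j = j' := Fin.ext h₂
  rfl

/-! ### Correctness of the program -/

/-- The memory `m` holds the data needed for the auction. -/
structure Prepared (I : Instance) (m : Memory) : Prop where
  total : m.nat 8 0 0 = I.unitTotal
  sellers : m.nat 9 0 0 = I.sellerTotal
  compat : m.nat 4 = I.input.nat 4
  seller : ∀ u : I.SUnit, m.nat 12 (I.number (.inl u)) 0 = u.1 ∧
    m.nat 13 (I.number (.inl u)) 0 = u.2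
  buyer : ∀ v : I.BUnit, m.nat 12 (I.number (.inr v)) 0 = v.1 ∧
    m.nat 13 (I.number (.inr v)) 0 = v.2
  value : ∀ x, m.real 2 (I.number x) 0 = Instance.value x
  key : ∀ x, m.key (I.number x) = Instance.key x
  price : ∀ x < I.unitTotal, m.nat 17 x 0 = (I.unitTotal + 2) * m.rank x I.unitTotal
  mate : ∀ x, m.nat 18 x 0 = 0
  output₆ : ∀ i j, m.nat 6 i j = 0
  output₇ : ∀ i j, m.nat 7 i j = 0

/-- A bound for the running time of the preparation. -/
def _root_.WaterTrading.prepareTime (B : ℕ) : ℕ :=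
  forTime (.sc 0) B (forTime (.ent 2 (.sc 10)) B flattenBody.time) +
  (6 + (forTime (.sc 1) B (forTime (.ent 3 (.sc 10)) B flattenBody.time) +
  (8 + (forTime (.sc 8) B attributesBody.time +
    forTime (.sc 8) B (forTime (.sc 8) B ranksBody.time)))))

theorem prepare_spec (I : Instance) :
    Spec prepare I.input (prepareTime I.size) (Prepared I) := by
  have hnS : I.nS ≤ I.size := by rw [size]; omega
  have hnB : I.nB ≤ I.size := by rw [size]; omega
  refine Spec.seq (flatten_spec (by omega) (by omega) I.input (γ := I.sellerUnits) (fun _ => rfl)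
    (n₀ := 0) (n := I.nS) rfl (by simp [input]) hnS sellerUnits_le_size) ?_
  rintro m₁ ⟨hN₁, hF₁⟩
  have s9 : Spec (.setNat 9 (.const 0) (.const 0) (.sc 8)) m₁ 6 fun m =>
      m = m₁.set 9 I.sellerTotal :=
    Spec.of_loopFree (P := .setNat 9 (.const 0) (.const 0) (.sc 8)) trivial (by
      simp [Program.exec, NExp.eval, Memory.set, hN₁.1, sellerTotal])
  refine Spec.seq s9 ?_
  rintro _ rfl
  refine Spec.seq (flatten_spec (by omega) (by omega) (m₁.set 9 I.sellerTotal) (γ := I.buyerUnits)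
    ?_ (n₀ := I.sellerTotal) (n := I.nB) ?_ ?_ hnB buyerUnits_le_size) ?_
  · intro b
    have := hF₁.1 3 (by decide)
    simp [Memory.set, update, this, buyerUnits]
  · simp [Memory.set, update, hN₁.1, sellerTotal]
  · have := hF₁.1 1 (by decide)
    simp [Memory.set, update, this, input]
  rintro m₃ ⟨hN₃, hF₃⟩
  have s16 : Spec (.setNat 16 (.const 0) (.const 0) (.add (.sc 8) (.const 2))) m₃ 8
      fun m => m = m₃.set 16 (I.unitTotal + 2) :=
    Spec.of_loopFree (P := .setNat 16 (.const 0) (.const 0) (.add (.sc 8) (.const 2))) trivial (by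
      simp [Program.exec, NExp.eval, Memory.set, hN₃.1, unitTotal])
  refine Spec.seq s16 ?_
  rintro _ rfl
  refine Spec.seq (attributes_spec (m₃.set 16 (I.unitTotal + 2)) (N := I.unitTotal) ?_
    unitTotal_le_size) ?_
  · simp [Memory.set, update, hN₃.1, unitTotal]
  rintro m₅ ⟨hA₅, hF₅⟩
  -- the arrays not written so far still hold the input
  have g : ∀ y, y ∉ [8, 9, 10, 11, 12, 13, 14, 15, 16] → m₅.nat y = I.input.nat y := by
    intro y hy
    simp only [List.mem_cons, List.not_mem_nil, or_false, not_or] at hy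
    have h1 := hF₁.1 y (by simp [flatten, flattenBody, Program.for, Program.natWrites]; omega)
    have h3 := hF₃.1 y (by simp [flatten, flattenBody, Program.for, Program.natWrites]; omega)
    have h5 := hF₅.1 y (by
      simp [attributes, attributesBody, Program.for, Program.natWrites]; omega)
    rw [h5]
    have e16 : (m₃.set 16 (I.unitTotal + 2)).nat y = m₃.nat y := by
      funext i k; simp [Memory.set, update, hy]
    have e9 : (m₁.set 9 I.sellerTotal).nat y = m₁.nat y := by
      funext i k; simp [Memory.set, update, hy]
    rw [e16, h3, e9, h1]
  have r₃ : ∀ y, m₃.real y = I.input.real y := by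
    intro y
    have h1 := hF₁.2 y (by simp [flatten, flattenBody, Program.for, Program.realWrites])
    have h3 := hF₃.2 y (by simp [flatten, flattenBody, Program.for, Program.realWrites])
    rw [h3, Memory.set, h1]
  have h8 : m₅.nat 8 0 0 = I.unitTotal := by
    rw [hF₅.1 8 (by decide)]
    simp [Memory.set, update, hN₃.1, unitTotal]
  have h9₃ : m₃.nat 9 0 0 = I.sellerTotal := by
    rw [hF₃.1 9 (by decide)]
    simp [Memory.set, update]
  have h9 : m₅.nat 9 0 0 = I.sellerTotal := by
    rw [hF₅.1 9 (by decide)]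
    simp [Memory.set, update, h9₃]
  have h16 : m₅.nat 16 0 0 = I.unitTotal + 2 := by
    rw [hF₅.1 16 (by decide)]
    simp [Memory.set, update]
  have h12 : m₅.nat 12 = m₃.nat 12 := by
    rw [hF₅.1 12 (by decide)]
    funext i k; simp [Memory.set, update]
  have h13 : m₅.nat 13 = m₃.nat 13 := by
    rw [hF₅.1 13 (by decide)]
    funext i k; simp [Memory.set, update]
  have hS : ∀ u : I.SUnit, m₃.nat 12 (I.number (.inl u)) 0 = u.1 ∧
      m₃.nat 13 (I.number (.inl u)) 0 = u.2 := by
    intro u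
    have h1 := hN₃.2.2 _ (number_inl_lt u)
    have h2 := hN₁.2.1 u.1 u.2 (by rw [sellerUnits_val]; exact u.2.isLt) (number_inl_lt u)
    rw [zero_add] at h2
    rw [h1.1, h1.2]
    simpa [Memory.set, update, number] using h2
  have hB : ∀ v : I.BUnit, m₃.nat 12 (I.number (.inr v)) 0 = v.1 ∧
      m₃.nat 13 (I.number (.inr v)) 0 = v.2 := fun v =>
    hN₃.2.1 v.1 v.2 (by rw [buyerUnits_val]; exact v.2.isLt)
      (offset_add_lt v.1.isLt (by rw [buyerUnits_val]; exact v.2.isLt))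
  have hval : ∀ x, m₅.real 2 (I.number x) 0 = Instance.value x ∧
      m₅.nat 14 (I.number x) 0 = tie x ∧ m₅.nat 15 (I.number x) 0 = mandatory x := by
    rintro (u | v)
    · have h := (hA₅ _ (number_lt (.inl u))).1 (by
        simpa [Memory.set, update, h9₃] using number_inl_lt u)
      obtain ⟨e1, e2⟩ := hS u
      simp only [Memory.set, update, r₃] at h
      simp [e1, e2] at h
      refine ⟨?_, h.2.1, h.2.2⟩
      rw [h.1]
      simp [input, Instance.value]
    · have h := (hA₅ _ (number_lt (.inr v))).2 (by
        simpa [Memory.set, update, h9₃] using le_number_inr v)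
      obtain ⟨e1, e2⟩ := hB v
      have e3 : m₃.nat 3 = I.input.nat 3 := by
        rw [← g 3 (by decide), hF₅.1 3 (by decide)]
        funext i k; simp [Memory.set, update]
      have e5 : m₃.nat 5 = I.input.nat 5 := by
        rw [← g 5 (by decide), hF₅.1 5 (by decide)]
        funext i k; simp [Memory.set, update]
      simp only [Memory.set, update, r₃] at h
      simp [e1, e2, e3, e5] at h
      refine ⟨?_, ?_, ?_⟩
      · rw [h.1]
        simp [input, Instance.value]
      · rw [h.2.1]
        simp [input, tie]
      · rw [h.2.2]
        simp [input, mandatory]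
  refine (ranks_spec m₅ h8 h16 ?_ unitTotal_le_size).mono le_rfl ?_
  · intro x
    rw [g 17 (by decide)]
    rfl
  rintro m₆ ⟨hR, hF₆⟩
  have w : ∀ y ∈ [4, 6, 7, 8, 9, 12, 13, 14, 15, 18], m₆.nat y = m₅.nat y := fun y hy =>
    hF₆.1 y (by revert y; decide)
  have w2 : m₆.real 2 = m₅.real 2 := hF₆.2 2 (by decide)
  have hkey : ∀ k, m₆.key k = m₅.key k := fun k => by
    simp only [Memory.key, w 14 (by decide), w 15 (by decide), w2]
  refine ⟨?_, ?_, ?_, ?_, ?_, ?_, ?_, ?_, ?_, ?_, ?_⟩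
  · rw [w 8 (by decide), h8]
  · rw [w 9 (by decide), h9]
  · rw [w 4 (by decide), g 4 (by decide)]
  · rw [w 12 (by decide), w 13 (by decide), h12, h13]; exact hS
  · rw [w 12 (by decide), w 13 (by decide), h12, h13]; exact hB
  · rw [w2]; exact fun x => (hval x).1
  · intro x
    obtain ⟨e1, e2, e3⟩ := hval x
    rw [hkey, Memory.key, e1, e2, e3, Instance.key]
  · intro x hx
    rw [hR x hx]
    simp only [Memory.rank, hkey]
  · rw [w 18 (by decide), g 18 (by decide)]; exact fun _ => rfl
  · rw [w 6 (by decide), g 6 (by decide)]; exact fun _ _ => rfl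
  · rw [w 7 (by decide), g 7 (by decide)]; exact fun _ _ => rfl

theorem _root_.WaterTrading.Memory.rank_le_iff (m : Memory) {x y n : ℕ} (hy : y < n) :
    m.rank x n ≤ m.rank y n ↔ m.key x ≤ m.key y := by
  constructor
  · intro h
    by_contra! hlt
    refine h.not_gt (Finset.card_lt_card ((Finset.ssubset_iff_of_subset ?_).2 ⟨y, ?_, ?_⟩))
    · intro z hz
      simp only [Finset.mem_filter] at hz ⊢
      exact ⟨hz.1, hz.2.trans hlt⟩
    · simp [hy, hlt]
    · simp
  · intro h
    refine Finset.card_le_card fun z hz => ?_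
    simp only [Finset.mem_filter] at hz ⊢
    exact ⟨hz.1, hz.2.trans_le h⟩

theorem Prepared.adj_iff {m : Memory} (h : Prepared I m) (u : I.SUnit) (v : I.BUnit) :
    m.Adj (I.number (.inl u)) (I.number (.inr v)) ↔ Tradable u v := by
  have hc : 0 < I.input.nat 4 u.1 v.1 ↔ I.compat u.1 v.1 := by
    by_cases h : I.compat u.1 v.1 <;> simp [input, h]
  rw [Memory.Adj, (h.seller u).1, (h.buyer v).1, h.compat, h.value, h.value, Tradable, hc]
  simp [Instance.value]

/-- A bound for the running time of the program on instances of size `B`. -/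
def _root_.WaterTrading.totalTime (B : ℕ) : ℕ :=
  prepareTime B + (auctionTime B ((B + 2) * B) + forTime (.sc 9) B writeOutputBody.time)

theorem tradingProgram_spec (hI : I.MonotoneValues)
    (hfeas : ∃ T : Finset (I.SUnit × I.BUnit), IsFeasible T) :
    Spec tradingProgram I.input (totalTime I.size) fun m =>
      IsValid (I.output m) ∧ (∀ b, I.r b ≤ assigned (I.output m) b) ∧
        ∀ T : Finset (I.SUnit × I.BUnit), IsFeasible T → welfare T ≤ welfare (I.output m) := by
  have hsz := I.unitTotal_le_size
  have hST : I.sellerTotal ≤ I.unitTotal := Nat.le_add_right _ _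
  refine Spec.seq (prepare_spec I) fun m₀ h₀ => ?_
  refine Spec.seq (auction_spec m₀ (M := (I.size + 2) * I.size) hST hsz h₀.total h₀.sellers ?_
    h₀.mate) ?_
  · intro x hx
    rw [h₀.price x hx]
    refine Nat.mul_le_mul (by omega) (le_trans ?_ hsz)
    exact (Finset.card_filter_le _ _).trans (by simp)
  rintro m₁ ⟨⟨hs, hdone⟩, hF₁⟩
  have e12 := hF₁.1 12 (by decide)
  have e13 := hF₁.1 13 (by decide)
  refine (writeOutput_spec m₁ (hST.trans hsz) (by rw [hF₁.1 9 (by decide), h₀.sellers]) ?_ ?_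
    ?_).mono le_rfl ?_
  · intro k hk k' hk' h1 h2
    obtain ⟨u, rfl⟩ := exists_number_inl hk
    obtain ⟨u', rfl⟩ := exists_number_inl hk'
    rw [e12, (h₀.seller u).1, (h₀.seller u').1] at h1
    rw [e13, (h₀.seller u).2, (h₀.seller u').2] at h2
    rw [SUnit.ext_val h1 h2]
  · rw [hF₁.1 6 (by decide)]; exact h₀.output₆
  · rw [hF₁.1 7 (by decide)]; exact h₀.output₇
  rintro m₂ ⟨hout, -⟩
  -- the output consists of the pairs matched by the auction
  have hmem : ∀ u v, (u, v) ∈ I.output m₂ ↔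
      m₁.nat 18 (I.number (.inl u)) 0 = I.number (.inr v) + 1 := by
    intro u v
    have h := hout _ (number_inl_lt u)
    rw [e12, e13, (h₀.seller u).1, (h₀.seller u).2] at h
    simp only [output, Finset.mem_filter, Finset.mem_univ, true_and, h.1, h.2]
    by_cases hm : m₁.nat 18 (I.number (.inl u)) 0 = 0
    · simp [hm]
    · obtain ⟨l, hl, hl', hml, -⟩ := hs.seller _ (number_inl_lt u) hm
      obtain ⟨v', rfl⟩ := exists_number_inr hl hl'
      rw [hml]
      simp only [Nat.succ_pos, if_true, Nat.add_sub_cancel, h₀.buyer v', Nat.add_right_cancel_iff]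
      constructor
      · rintro ⟨g1, g2⟩
        rw [BUnit.ext_val g1 g2]
      · intro hn
        obtain ⟨g1, g2⟩ := h₀.buyer v
        rw [← hn, (h₀.buyer v').1] at g1
        rw [← hn, (h₀.buyer v').2] at g2
        exact ⟨g1, g2⟩
  have hinlr : ∀ {u v}, (u, v) ∈ I.output m₂ → Tradable u v ∧
      m₁.nat 18 (I.number (.inr v)) 0 = I.number (.inl u) + 1 ∧
      m₁.nat 17 (I.number (.inl u)) 0 ≤ m₀.nat 17 (I.number (.inr v)) 0 ∧
      ∀ u', Tradable u' v →
        m₁.nat 17 (I.number (.inl u)) 0 ≤ m₁.nat 17 (I.number (.inl u')) 0 + 1 := by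
    intro u v huv
    have h1 := (hmem u v).1 huv
    obtain ⟨l, -, -, h2, h3, h4, h5, h6⟩ := hs.seller _ (number_inl_lt u) (by omega)
    obtain rfl : l = I.number (.inr v) := by omega
    exact ⟨(h₀.adj_iff u v).1 h4, h3, h5,
      fun u' hu' => h6 _ (number_inl_lt u') ((h₀.adj_iff u' v).2 hu')⟩
  have hnum : ∀ {u u' : I.SUnit}, I.number (.inl u) = I.number (.inl u') → u = u' := by
    intro u u' h
    refine SUnit.ext_val ?_ ?_
    · rw [← (h₀.seller u).1, h, (h₀.seller u').1]
    · rw [← (h₀.seller u).2, h, (h₀.seller u').2]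
  have hnum' : ∀ {v v' : I.BUnit}, I.number (.inr v) = I.number (.inr v') → v = v' := by
    intro v v' h
    refine BUnit.ext_val ?_ ?_
    · rw [← (h₀.buyer v).1, h, (h₀.buyer v').1]
    · rw [← (h₀.buyer v).2, h, (h₀.buyer v').2]
  have hT₁ : ∀ p ∈ I.output m₂, ∀ q ∈ I.output m₂, p.1 = q.1 → p = q := by
    rintro ⟨u, v⟩ hp ⟨u', v'⟩ hq (rfl : u = u')
    have h1 := (hmem _ _).1 hp
    have h2 := (hmem _ _).1 hq
    rw [hnum' (v := v) (v' := v') (by omega)]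
  have hT₂ : ∀ p ∈ I.output m₂, ∀ q ∈ I.output m₂, p.2 = q.2 → p = q := by
    rintro ⟨u, v⟩ hp ⟨u', v'⟩ hq (rfl : v = v')
    have h1 := (hinlr hp).2.1
    have h2 := (hinlr hq).2.1
    rw [hnum (u := u) (u' := u') (by omega)]
  -- the final prices clear the market for the scaled ranks, up to an error of `1`
  have hcl : Clearing 1 Tradable (I.output m₂)
      (fun u => (I.unitTotal + 2) * m₀.rank (I.number (.inl u)) I.unitTotal)
      (fun v => (I.unitTotal + 2) * m₀.rank (I.number (.inr v)) I.unitTotal)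
      (fun u => m₁.nat 17 (I.number (.inl u)) 0) := by
    refine ⟨?_, ?_, ?_, ?_, ?_⟩
    · intro u
      rw [← h₀.price _ (number_lt _)]
      exact hs.cost_le _ (number_inl_lt u)
    · intro u hu
      rw [← h₀.price _ (number_lt _)]
      refine hs.free _ (number_inl_lt u) ?_
      by_contra hne
      obtain ⟨l, hl, hl', h2, -⟩ := hs.seller _ (number_inl_lt u) hne
      obtain ⟨v, rfl⟩ := exists_number_inr hl hl'
      exact hu v ((hmem u v).2 h2)
    · intro u v huv
      rw [← h₀.price _ (number_lt _)]
      exact (hinlr huv).2.2.1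
    · intro u v u' huv htr
      exact (hinlr huv).2.2.2 u' htr
    · intro v hv u htr
      rw [← h₀.price _ (number_lt _)]
      refine hdone _ (le_number_inr v) (number_inr_lt v) ?_ _ (number_inl_lt u)
        ((h₀.adj_iff u v).2 htr)
      by_contra hne
      obtain ⟨k, hk, -, h2⟩ := hs.buyer _ (le_number_inr v) (number_inr_lt v) hne
      obtain ⟨u', rfl⟩ := exists_number_inl hk
      exact hv u' ((hmem u' v).2 h2)
  obtain ⟨π, hπ⟩ := hcl.exists_rounding (by
    rw [Fintype.card_sigma]
    simp only [Fintype.card_fin]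
    rw [← sellerTotal_eq]
    omega)
  refine optimal_of_clearing hI hfeas hT₁ hT₂ (fun p hp => (hinlr hp).1)
    (rk := fun x => m₀.rank (I.number x) I.unitTotal) ?_ hπ
  intro x y
  rw [m₀.rank_le_iff (number_lt y), h₀.key, h₀.key]

end Instance

/-! ### Polynomial running time -/

/-- The function `f` is given by a polynomial. -/
def IsPoly (f : ℕ → ℕ) : Prop := ∃ p : Polynomial ℕ, ∀ n, f n = p.eval n

theorem IsPoly.const (c : ℕ) : IsPoly fun _ => c := ⟨.C c, fun n => by simp⟩

theorem IsPoly.id : IsPoly fun n => n := ⟨.X, fun n => by simp⟩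

theorem IsPoly.add {f g : ℕ → ℕ} (hf : IsPoly f) (hg : IsPoly g) : IsPoly fun n => f n + g n := by
  obtain ⟨p, hp⟩ := hf
  obtain ⟨q, hq⟩ := hg
  exact ⟨p + q, fun n => by simp [hp, hq]⟩

theorem IsPoly.mul {f g : ℕ → ℕ} (hf : IsPoly f) (hg : IsPoly g) : IsPoly fun n => f n * g n := by
  obtain ⟨p, hp⟩ := hf
  obtain ⟨q, hq⟩ := hg
  exact ⟨p * q, fun n => by simp [hp, hq]⟩

theorem isPoly_forTime (e : NExp) {f : ℕ → ℕ} (hf : IsPoly f) : IsPoly fun n => forTime e n (f n) :=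
  .add (.const _) (.add (.mul .id (.add (.const _) (.add hf (.const _)))) (.const _))

theorem isPoly_prepareTime : IsPoly prepareTime :=
  .add (isPoly_forTime _ (isPoly_forTime _ (.const _))) <| .add (.const _) <|
  .add (isPoly_forTime _ (isPoly_forTime _ (.const _))) <| .add (.const _) <|
  .add (isPoly_forTime _ (.const _)) (isPoly_forTime _ (isPoly_forTime _ (.const _)))

theorem isPoly_stepTime : IsPoly stepTime :=
  .add (.const _) <| .add (.const _) <|
  .add (.add (.const _) (.add (.const _) (isPoly_forTime _ (.const _)))) (.const _)

theorem isPoly_totalTime : IsPoly totalTime := by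
  refine .add isPoly_prepareTime (.add ?_ (isPoly_forTime _ (.const _)))
  refine .add (.const _) (.add (.mul (.add (.mul (.mul .id ?_) (.add .id (.const _))) .id)
    (.add (.const _) isPoly_stepTime)) (.const _))
  exact .mul (.add .id (.const _)) .id

end WaterTrading

theorem mainTheorem6 :
    ∃ (P : WaterTrading.Program) (p : Polynomial ℕ),
      ∀ I : WaterTrading.Instance, I.MonotoneValues →
        (∃ T : Finset (I.SUnit × I.BUnit), WaterTrading.Instance.IsFeasible T) →
        ∃ (m : WaterTrading.Memory) (t : ℕ),
          WaterTrading.Runs P I.input m t ∧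
          t ≤ p.eval I.size ∧
          WaterTrading.Instance.IsValid (I.output m) ∧
          (∀ b : Fin I.nB, I.r b ≤ WaterTrading.Instance.assigned (I.output m) b) ∧
          (∀ T : Finset (I.SUnit × I.BUnit), WaterTrading.Instance.IsFeasible T →
            WaterTrading.Instance.welfare T ≤ WaterTrading.Instance.welfare (I.output m)) := by
  obtain ⟨p, hp⟩ := WaterTrading.isPoly_totalTime
  refine ⟨WaterTrading.tradingProgram, p, fun I hI hfeas => ?_⟩
  obtain ⟨m, t, hr, ht, hq⟩ := WaterTrading.Instance.tradingProgram_spec hI hfeas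
  exact ⟨m, t, hr, hp _ ▸ ht, hq⟩
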